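/- Let $\mathbb K$ be a field. A *digraph* is a finite set of vertices with a set of ordered pairs of distinct vertices, its edges. A *simple path* is a sequence of edges $e_1,\dots,e_m$ ($m\ge 1$) such that the target of $e_i$ is the source of $e_{i+1}$, no two $e_i$ have the same source or the same target, and the source of $e_1$ is not the target of $e_m$; its length is $m$. A *multipath* of a digraph $G$ is a spanning subgraph each of whose connected components is either a single vertex or has edges that can be ordered to form a simple path. Fix a total order on the edges of $G$. Let $C^d_\mu(G;\mathbb K)$ be the $\mathbb K$-vector space with basis $b_H$, $H$ running over the multipaths of $G$ with $d$ edges, and let $$d(b_H)=\sum_{H'=H\cup\{e\}\text{ a multipath}}(-1)^{\#\{e'\in E(H)\,:\,e'<e\}}\,b_{H'} .$$ The cohomology of this cochain complex is the *multipath cohomology* $H^*_\mu(G;\mathbb K)$; it does not depend on the order, up to isomorphism. An *oriented linear graph* $L$ is a digraph with vertices $v_0,\dots,v_n$ ($n\ge 0$) such that for each $i\in\{1,\dots,n\}$ exactly one of $(v_{i-1},v_i)$, $(v_i,v_{i-1})$ is an edge, and there are no other edges. It is *alternating* if no vertex is both the source of an edge and the target of an edge; $A_n$ denotes any alternating linear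 graph on $n+1$ vertices (it is unique up to reversing all edges). A vertex of $L$ is *stable* if it is not both the source of an edge and the target of an edge. $L$ satisfies $D(k)$ if every simple path of $L$ that joins two stable vertices has length at most $k$. The *reduction* $\mathrm{Red}\,L$ is the spanning subgraph obtained from $L$ by deleting, for each maximal simple path of $L$, with vertices $v_a,v_{a+1},\dots,v_{a+m}$, all of its edges except the one between $v_{a+m-1}$ and $v_{a+m}$. **Theorem.** Let $L$ be an oriented linear graph on $n+1$ vertices. (i) Suppose that $L$ satisfies $D(2)$ but not $D(1)$. The connected components of $\mathrm{Red}\,L$, ordered by their vertices of minimal index, are alternating graphs $A_{k_1},\dots,A_{k_h}$, and: 1. if $k_j\equiv 0 \pmod 3$ for some $j\in\{1,\dots,h-1\}$, then $H^*_\mu(L;\mathbb K)=0$; 2. otherwise there is an isomorphism of graded vector spaces $$H^{*+h-1}_\mu(L;\mathbb K)\cong H^*_\mu(A_{3\lfloor k_1/3\rfloor};\mathbb K)\otimes\cdots\otimes H^*_\mu(A_{3\lfloor k_{h-1}/3\rfloor};\mathbb K)\otimes H^*_\mu(A_{k_h};\mathbb K),$$ where $\otimes$ is the graded tensor product over $\mathbb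 K$. In particular $H^d_\mu(L;\mathbb K)=0$ for $d<h-1$. (ii) If $L$ does not satisfy $D(2)$, then $H^*_\mu(L;\mathbb K)=0$. (iii) $L$ satisfies $D(1)$ if and only if it is alternating, and then, for all $d\ge 0$, $H^d_\mu(L;\mathbb K)\cong\mathbb K$ if $n=3(d-1)+2$ or $n=3d$, and $H^d_\mu(L;\mathbb K)=0$ otherwise. -/

import Mathlib

open CategoryTheory
open scoped DirectSum TensorProduct

universe u v

namespace Digraph

section Multipath

variable {V : Type v}

/-- A simple path, as a sequence of `m + 1` edges (pairs source, target): consecutive edges are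
composable, no vertex is encountered twice, and the path does not close up to a cycle. -/
structure IsSimplePath {m : ℕ} (p : Fin (m + 1) → V × V) : Prop where
  composable : ∀ i : Fin m, (p i.castSucc).2 = (p i.succ).1
  source_injective : Function.Injective fun i => (p i).1
  target_injective : Function.Injective fun i => (p i).2
  not_cycle : (p 0).1 ≠ (p (Fin.last m)).2

/-- The spanning subgraph on the vertex set `V` with set of edges `H`. -/
def spanningSubgraph (H : Finset (V × V)) : Digraph V := ⟨fun a b => (a, b) ∈ H⟩

/-- A spanning subgraph (given by its finite set `H` of edges) all of whose connected components
are either a vertex without edges, or have edges which can be ordered to form a simple path. -/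
def IsPathUnion (H : Finset (V × V)) : Prop :=
  ∀ c : (spanningSubgraph H).toSimpleGraphInclusive.ConnectedComponent,
    (∀ e ∈ H, e.1 ∉ c.supp) ∨
      ∃ (m : ℕ) (p : Fin (m + 1) → V × V), IsSimplePath p ∧
        ∀ e, e ∈ Set.range p ↔ e ∈ H ∧ e.1 ∈ c.supp

/-- The multipaths of `G`, each given by its finite set of edges. -/
def IsMultipath (G : Digraph V) (H : Finset (V × V)) : Prop :=
  (∀ e ∈ H, G.Adj e.1 e.2) ∧ IsPathUnion H

theorem IsPathUnion.exists_path {H : Finset (V × V)} (h : IsPathUnion H)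
    {e : V × V} (he : e ∈ H) : ∃ (m : ℕ) (p : Fin (m + 1) → V × V), IsSimplePath p ∧
      ∀ f, f ∈ Set.range p ↔ f ∈ H ∧
        f.1 ∈ ((spanningSubgraph H).toSimpleGraphInclusive.connectedComponentMk e.1).supp := by
  rcases h ((spanningSubgraph H).toSimpleGraphInclusive.connectedComponentMk e.1) with h | h
  · exact absurd rfl (h e he)
  · exact h

theorem connectedComponentMk_snd {H : Finset (V × V)} {e : V × V} (he : e ∈ H) :
    (spanningSubgraph H).toSimpleGraphInclusive.connectedComponentMk e.2 =
      (spanningSubgraph H).toSimpleGraphInclusive.connectedComponentMk e.1 := by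
  by_cases hne : e.1 = e.2
  · rw [hne]
  · refine SimpleGraph.ConnectedComponent.eq.mpr (SimpleGraph.Adj.reachable ?_)
    exact ⟨fun h => hne h.symm, Or.inr he⟩

/-- Local description of unions of disjoint simple paths. -/
theorem isPathUnion_iff {H : Finset (V × V)} : IsPathUnion H ↔
    (∀ e ∈ H, ∀ f ∈ H, e.1 = f.1 → e = f) ∧ (∀ e ∈ H, ∀ f ∈ H, e.2 = f.2 → e = f) ∧
      ∃ φ : V → ℕ, ∀ e ∈ H, φ e.1 < φ e.2 := by
  classical
  constructor
  · intro h
    refine ⟨?_, ?_, ?_⟩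
    · intro e he f hf hef
      obtain ⟨m, p, hp, hr⟩ := h.exists_path he
      obtain ⟨i, rfl⟩ := (hr e).2 ⟨he, rfl⟩
      obtain ⟨j, rfl⟩ := (hr f).2 ⟨hf, by rw [← hef]; rfl⟩
      rw [hp.source_injective hef]
    · intro e he f hf hef
      obtain ⟨m, p, hp, hr⟩ := h.exists_path he
      obtain ⟨i, rfl⟩ := (hr e).2 ⟨he, rfl⟩
      obtain ⟨j, rfl⟩ := (hr f).2 ⟨hf, by
        rw [SimpleGraph.ConnectedComponent.mem_supp_iff, ← connectedComponentMk_snd hf,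
          ← hef, connectedComponentMk_snd he]⟩
      rw [hp.target_injective hef]
    · have key : ∀ c : (spanningSubgraph H).toSimpleGraphInclusive.ConnectedComponent,
          ∃ ψ : V → ℕ, ∀ e ∈ H, e.1 ∈ c.supp → ψ e.1 < ψ e.2 := by
        intro c
        rcases h c with hc | ⟨m, p, hp, hr⟩
        · exact ⟨fun _ => 0, fun e he hec => absurd hec (hc e he)⟩
        · refine ⟨fun v => if hv : ∃ i, (p i).2 = v then (hv.choose : ℕ) + 1 else 0, ?_⟩
          intro e he hec
          obtain ⟨i, rfl⟩ := (hr e).2 ⟨he, hec⟩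
          have val : ∀ i, (if hv : ∃ j, (p j).2 = (p i).2 then (hv.choose : ℕ) + 1 else 0) =
              (i : ℕ) + 1 := by
            intro i
            have hv : ∃ j, (p j).2 = (p i).2 := ⟨i, rfl⟩
            rw [dif_pos hv, hp.target_injective hv.choose_spec]
          simp only [val]
          induction i using Fin.cases with
          | succ i =>
            rw [← hp.composable i]
            simp only [val]
            simp
          | zero =>
            rw [dif_neg]
            · simp
            · rintro ⟨j, hj⟩
              induction j using Fin.lastCases with
              | last => exact hp.not_cycle hj.symm
              | cast j =>
                rw [hp.composable j] at hj
                exact Fin.succ_ne_zero j (hp.source_injective hj)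
      choose ψ hψ using key
      refine ⟨fun v => ψ ((spanningSubgraph H).toSimpleGraphInclusive.connectedComponentMk v) v,
        fun e he => ?_⟩
      have := hψ ((spanningSubgraph H).toSimpleGraphInclusive.connectedComponentMk e.1) e he rfl
      simpa only [connectedComponentMk_snd he] using this
  · rintro ⟨hs, ht, φ, hφ⟩ c
    by_cases hc : ∀ e ∈ H, e.1 ∉ c.supp
    · exact Or.inl hc
    right
    push Not at hc
    obtain ⟨e₀, he₀, hc₀⟩ := hc
    -- some path through the component absorbs all edges that touch it
    obtain ⟨m, p, hp, hpH, hpc, hcl⟩ : ∃ (m : ℕ) (p : Fin (m + 1) → V × V), IsSimplePath p ∧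
        (∀ i, p i ∈ H) ∧ (∀ i, (p i).1 ∈ c.supp) ∧
        ∀ e ∈ H, (∃ i, e.1 = (p i).1 ∨ e.1 = (p i).2 ∨ e.2 = (p i).1 ∨ e.2 = (p i).2) →
          e ∈ Set.range p := by
      by_contra hno
      push Not at hno
      have mono : ∀ {m : ℕ} (p : Fin (m + 1) → V × V), (∀ i, p i ∈ H) →
          (∀ i : Fin m, (p i.castSucc).2 = (p i.succ).1) →
          StrictMono fun i => φ (p i).1 := by
        intro m p hpH hcomp
        rw [Fin.strictMono_iff_lt_succ]
        intro i
        have := hφ _ (hpH i.castSucc)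
        rwa [hcomp i] at this
      have mk : ∀ {m : ℕ} (p : Fin (m + 1) → V × V), (∀ i, p i ∈ H) →
          (∀ i : Fin m, (p i.castSucc).2 = (p i.succ).1) → IsSimplePath p := by
        intro m p hpH hcomp
        have h1 : Function.Injective fun i => (p i).1 := fun i j hij =>
          (mono p hpH hcomp).injective (congrArg φ hij)
        refine ⟨hcomp, h1, ?_, ?_⟩
        · intro i j hij
          exact h1 (congrArg Prod.fst (ht _ (hpH i) _ (hpH j) hij))
        · intro h0
          have a : φ (p 0).1 ≤ φ (p (Fin.last m)).1 :=
            (mono p hpH hcomp).monotone (Fin.zero_le (Fin.last m))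
          have b := hφ _ (hpH (Fin.last m))
          rw [← h0] at b
          omega
      have grow : ∀ m : ℕ, ∃ p : Fin (m + 1) → V × V, (∀ i, p i ∈ H) ∧
          (∀ i, (p i).1 ∈ c.supp) ∧ ∀ i : Fin m, (p i.castSucc).2 = (p i.succ).1 := by
        intro m
        induction m with
        | zero => exact ⟨fun _ => e₀, fun _ => he₀, fun _ => hc₀, fun i => i.elim0⟩
        | succ m ih =>
          obtain ⟨p, hpH, hpc, hcomp⟩ := ih
          obtain ⟨e, he, ⟨i, hi⟩, hr⟩ := hno m p (mk p hpH hcomp) hpH hpc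
          have supp2 : ∀ f ∈ H, f.1 ∈ c.supp ↔ f.2 ∈ c.supp := by
            intro f hf
            rw [SimpleGraph.ConnectedComponent.mem_supp_iff,
              SimpleGraph.ConnectedComponent.mem_supp_iff, connectedComponentMk_snd hf]
          have hn1 : ∀ i, e.1 ≠ (p i).1 := fun i h => hr ⟨i, (hs _ he _ (hpH i) h).symm⟩
          have hn2 : ∀ i, e.2 ≠ (p i).2 := fun i h => hr ⟨i, (ht _ he _ (hpH i) h).symm⟩
          rcases hi with hi | hi | hi | hi
          · exact absurd hi (hn1 i)
          · -- append the edge at the end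
            have hl : i = Fin.last m := by
              induction i using Fin.lastCases with
              | last => rfl
              | cast i => rw [hcomp i] at hi; exact absurd hi (hn1 _)
            subst hl
            refine ⟨Fin.snoc p e, ?_, ?_, ?_⟩
            · intro j
              induction j using Fin.lastCases with
              | last => simpa using he
              | cast j => simpa using hpH j
            · intro j
              induction j using Fin.lastCases with
              | last =>
                rw [Fin.snoc_last, hi]
                exact (supp2 _ (hpH _)).1 (hpc _)
              | cast j => simpa using hpc j
            · intro j
              induction j using Fin.lastCases with
              | last =>
                rw [Fin.succ_last, Fin.snoc_last, Fin.snoc_castSucc]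
                exact hi.symm
              | cast j =>
                rw [Fin.succ_castSucc, Fin.snoc_castSucc, Fin.snoc_castSucc]
                exact hcomp j
          · -- insert the edge at the beginning
            have hl : i = 0 := by
              induction i using Fin.cases with
              | zero => rfl
              | succ i => rw [← hcomp i] at hi; exact absurd hi (hn2 _)
            subst hl
            refine ⟨Fin.cons e p, ?_, ?_, ?_⟩
            · intro j
              induction j using Fin.cases with
              | zero => simpa using he
              | succ j => simpa using hpH j
            · intro j
              induction j using Fin.cases with
              | zero =>
                rw [Fin.cons_zero, supp2 _ he, hi]
                exact hpc _
              | succ j => simpa using hpc j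
            · intro j
              induction j using Fin.cases with
              | zero =>
                rw [Fin.castSucc_zero, Fin.cons_zero, Fin.cons_succ]
                exact hi
              | succ j =>
                rw [Fin.castSucc_succ, Fin.cons_succ, Fin.cons_succ]
                exact hcomp j
          · exact absurd hi (hn2 i)
      obtain ⟨p, hpH, -, hcomp⟩ := grow H.card
      have hinj : Function.Injective p := fun i j hij =>
        (mk p hpH hcomp).source_injective (congrArg Prod.fst hij)
      have := Finset.card_le_card_of_injOn (s := Finset.univ) (t := H) p
        (fun i _ => hpH i) hinj.injOn
      simp at this
    refine ⟨m, p, hp, fun e => ⟨?_, ?_⟩⟩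
    · rintro ⟨i, rfl⟩
      exact ⟨hpH i, hpc i⟩
    · rintro ⟨he, hec⟩
      have reach : ∀ {a b : V}, (spanningSubgraph H).toSimpleGraphInclusive.Reachable a b →
          (∃ i, a = (p i).1 ∨ a = (p i).2) → ∃ i, b = (p i).1 ∨ b = (p i).2 := by
        intro a b hab
        obtain ⟨w⟩ := hab
        induction w with
        | nil => exact id
        | cons hadj _ ih =>
          intro ha
          apply ih
          obtain ⟨i, hi⟩ := ha
          rcases hadj.2 with hH | hH
          · obtain ⟨j, hj⟩ := hcl _ hH ⟨i, by tauto⟩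
            exact ⟨j, Or.inr (by rw [hj])⟩
          · obtain ⟨j, hj⟩ := hcl _ hH ⟨i, by tauto⟩
            exact ⟨j, Or.inl (by rw [hj])⟩
      have hreach : (spanningSubgraph H).toSimpleGraphInclusive.Reachable (p 0).1 e.1 :=
        SimpleGraph.ConnectedComponent.exact ((hpc 0).trans hec.symm)
      obtain ⟨i, hi⟩ := reach hreach ⟨0, Or.inl rfl⟩
      exact hcl e he ⟨i, by tauto⟩

/-- The path poset is downward closed in the poset of spanning subgraphs. -/
theorem IsMultipath.mono {G : Digraph V} {H H' : Finset (V × V)} (h : G.IsMultipath H')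
    (hs : H ⊆ H') : G.IsMultipath H := by
  refine ⟨fun e he => h.1 e (hs he), ?_⟩
  obtain ⟨h1, h2, φ, h3⟩ := isPathUnion_iff.1 h.2
  exact isPathUnion_iff.2 ⟨fun e he f hf => h1 e (hs he) f (hs hf),
    fun e he f hf => h2 e (hs he) f (hs hf), φ, fun e he => h3 e (hs he)⟩

end Multipath

section Cohomology

variable {V : Type v} [Fintype V] [LinearOrder V]

set_option linter.unusedSectionVars false

/-- The multipaths of `G` with `d` edges. -/
def MultipathOfLength (G : Digraph V) (d : ℕ) : Type v :=
  {H : Finset (V × V) // G.IsMultipath H ∧ H.card = d}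

/-- Deleting an edge from a multipath. -/
def MultipathOfLength.erase {G : Digraph V} {d : ℕ} (H : G.MultipathOfLength (d + 1))
    (e : V × V) (he : e ∈ H.1) : G.MultipathOfLength d :=
  ⟨H.1.erase e, H.2.1.mono (Finset.erase_subset e H.1), by
    rw [Finset.card_erase_of_mem he, H.2.2]; rfl⟩

/-- The sign `(-1) ^ ε` of the covering relation `H \ {e} ≺ H`, where `ε` is the number of edges
of `H` which precede `e` in the lexicographic order of the edges. -/
def coverSign (K : Type u) [CommRing K] (H : Finset (V × V)) (e : V × V) : K :=
  (-1) ^ (H.filter fun f => toLex f < toLex e).card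

variable (K : Type u) [Field K]

/-- The differential of the multipath complex. In degree `d` the cochains are the `K`-valued
functions on the (finite) set of multipaths with `d` edges, that is, the coordinates with respect
to the basis `b_H` of multipaths. On this basis the differential sends `b_H` to the sum over all
multipaths `H' = H ∪ {e}` of the vectors `± b_{H'}`. -/
def multipathDifferential (G : Digraph V) (d : ℕ) :
    (G.MultipathOfLength d → K) →ₗ[K] (G.MultipathOfLength (d + 1) → K) where
  toFun f H := ∑ e ∈ H.1.attach, coverSign K H.1 e.1 * f (H.erase e.1 e.2)
  map_add' f g := by
    funext H
    simp [mul_add, Finset.sum_add_distrib]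
  map_smul' a f := by
    funext H
    simp [Finset.mul_sum, mul_left_comm]

theorem coverSign_erase_of_lt {H : Finset (V × V)} {e f : V × V} (hf : f ∈ H)
    (hlt : toLex f < toLex e) : coverSign K (H.erase f) e = - coverSign K H e := by
  unfold coverSign
  rw [Finset.filter_erase, Finset.card_erase_of_mem (by simp [hf, hlt])]
  have hpos : 0 < (H.filter fun x => toLex x < toLex e).card :=
    Finset.card_pos.2 ⟨f, by simp [hf, hlt]⟩
  obtain ⟨k, hk⟩ := Nat.exists_eq_succ_of_ne_zero hpos.ne'
  rw [hk]
  simp [pow_succ]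

theorem coverSign_erase_of_gt {H : Finset (V × V)} {e f : V × V}
    (hlt : toLex e < toLex f) : coverSign K (H.erase f) e = coverSign K H e := by
  unfold coverSign
  rw [Finset.filter_erase, Finset.erase_eq_of_notMem]
  simp [hlt.le]

theorem multipathDifferential_comp (G : Digraph V) (d : ℕ) :
    multipathDifferential K G (d + 1) ∘ₗ multipathDifferential K G d = 0 := by
  classical
  ext1 f
  funext H
  simp only [LinearMap.comp_apply, multipathDifferential, LinearMap.coe_mk, AddHom.coe_mk,
    LinearMap.zero_apply, Pi.zero_apply, Finset.mul_sum]
  let F : Finset (V × V) → K := fun A =>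
    if h : G.IsMultipath A ∧ A.card = d then f ⟨A, h⟩ else 0
  have hF : ∀ A : G.MultipathOfLength d, f A = F A.1 := fun A => by
    simp only [F]; rw [dif_pos A.2]; rfl
  have step : ∀ e : {x // x ∈ H.1},
      (∑ e' ∈ (H.erase e.1 e.2).1.attach, coverSign K H.1 e.1 *
        (coverSign K (H.erase e.1 e.2).1 e'.1 * f ((H.erase e.1 e.2).erase e'.1 e'.2))) =
      ∑ e' ∈ H.1.erase e.1, coverSign K H.1 e.1 *
        (coverSign K (H.1.erase e.1) e' * F ((H.1.erase e.1).erase e')) := by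
    intro e
    rw [← Finset.sum_attach (H.1.erase e.1)]
    refine Finset.sum_congr rfl fun e' _ => ?_
    rw [hF]
    rfl
  rw [Finset.sum_congr rfl fun e _ => step e]
  rw [Finset.sum_attach H.1 fun e => ∑ e' ∈ H.1.erase e, coverSign K H.1 e *
    (coverSign K (H.1.erase e) e' * F ((H.1.erase e).erase e'))]
  rw [Finset.sum_sigma']
  refine Finset.sum_involution (fun x _ => ⟨x.2, x.1⟩) ?_ ?_ ?_ ?_
  · rintro ⟨a, b⟩ hx
    simp only [Finset.mem_sigma, Finset.mem_erase] at hx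
    obtain ⟨ha, hba, hb⟩ := hx
    simp only
    rw [Finset.erase_right_comm (a := b) (b := a)]
    rcases lt_or_gt_of_ne (fun h : toLex a = toLex b => hba (toLex.injective h).symm) with h | h
    · rw [coverSign_erase_of_lt K ha h, coverSign_erase_of_gt K h]
      ring
    · rw [coverSign_erase_of_lt K hb h, coverSign_erase_of_gt K h]
      ring
  · rintro ⟨a, b⟩ hx _ h
    simp only [Finset.mem_sigma, Finset.mem_erase] at hx
    simp only [Sigma.mk.injEq] at h
    exact hx.2.1 h.1
  · rintro ⟨a, b⟩ hx
    simp only [Finset.mem_sigma, Finset.mem_erase] at hx ⊢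
    exact ⟨hx.2.2, fun h => hx.2.1 h.symm, hx.1⟩
  · rintro ⟨a, b⟩ _
    rfl

/-- The multipath cochain complex of a finite digraph with coefficients in a field `K`. -/
noncomputable def multipathComplex (G : Digraph V) : CochainComplex (ModuleCat.{max u v} K) ℕ :=
  CochainComplex.of (fun d => ModuleCat.of K (G.MultipathOfLength d → K))
    (fun d => ModuleCat.ofHom (multipathDifferential K G d))
    (fun d => by
      rw [← ModuleCat.ofHom_comp, multipathDifferential_comp]
      rfl)

/-- The multipath cohomology `H_μ^d(G; K)`. -/
noncomputable def multipathCohomology (G : Digraph V) (d : ℕ) : ModuleCat.{max u v} K :=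
  (multipathComplex K G).homology d

end Cohomology

section Linear

/-- An oriented linear graph on the vertices `v_0, …, v_{n-1}`: for consecutive indices exactly
one of the two possible edges is present, and there are no other edges. -/
def IsOrientedLinear {n : ℕ} (L : Digraph (Fin n)) : Prop :=
  (∀ i j : Fin n, (i : ℕ) + 1 = j → Xor (L.Adj i j) (L.Adj j i)) ∧
    ∀ i j : Fin n, L.Adj i j → (i : ℕ) + 1 = j ∨ (j : ℕ) + 1 = i

/-- An alternating (oriented linear) graph. If it has `n + 1` vertices it is an `A_n`. -/
def IsAlternating {n : ℕ} (L : Digraph (Fin n)) : Prop :=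
  L.IsOrientedLinear ∧ ∀ i j k : Fin n, (i : ℕ) + 1 = j → (j : ℕ) + 1 = k →
    (L.Adj i j → L.Adj k j) ∧ (L.Adj j i → L.Adj j k)

/-- A vertex is stable unless it is both the target and the source of an edge. -/
def IsStable {V : Type v} (L : Digraph V) (x : V) : Prop :=
  ¬ ((∃ y, L.Adj x y) ∧ ∃ y, L.Adj y x)

/-- A simple path all of whose edges belong to `L`. -/
def IsSimplePathIn {V : Type v} (L : Digraph V) {m : ℕ} (p : Fin (m + 1) → V × V) : Prop :=
  IsSimplePath p ∧ ∀ i, L.Adj (p i).1 (p i).2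

/-- The property `D(k)`: any two stable vertices have distance at most `k`, where the distance is
the length (number of edges) of the simple path that joins them if there is one, and `-∞`
otherwise. -/
def PropertyD {V : Type v} (L : Digraph V) (k : ℕ) : Prop :=
  ∀ x y : V, L.IsStable x → L.IsStable y →
    ∀ (m : ℕ) (p : Fin (m + 1) → V × V), L.IsSimplePathIn p →
      (p 0).1 = x → (p (Fin.last m)).2 = y → m + 1 ≤ k

/-- A simple path of `L` which is not properly contained in another simple path of `L`. -/
def IsMaximalSimplePathIn {V : Type v} (L : Digraph V) {m : ℕ} (p : Fin (m + 1) → V × V) : Prop :=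
  L.IsSimplePathIn p ∧ ∀ (m' : ℕ) (p' : Fin (m' + 1) → V × V), L.IsSimplePathIn p' →
    Set.range p ⊆ Set.range p' → Set.range p' = Set.range p

/-- The reduction of an oriented linear graph: on each maximal simple path, with vertices
`v_a, …, v_{a+m}`, all edges are deleted except the one between `v_{a+m-1}` and `v_{a+m}`. So an
edge survives if no edge of the maximal simple path through it reaches a larger index. -/
def reduction {n : ℕ} (L : Digraph (Fin n)) : Digraph (Fin n) where
  Adj a b := L.Adj a b ∧ ∀ (m : ℕ) (p : Fin (m + 1) → Fin n × Fin n),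
    L.IsMaximalSimplePathIn p → (a, b) ∈ Set.range p → ∀ i, max (p i).1 (p i).2 ≤ max a b

/-- The connected components of `G`, ordered by their vertices of minimal index, are alternating
graphs `A_{k_1}, …, A_{k_h}`. (The list `k` is indexed by `0, …, h - 1`.) -/
def HasAlternatingComponents {n : ℕ} (G : Digraph (Fin n)) {h : ℕ} (k : Fin h → ℕ) : Prop :=
  ∃ c : Fin h ≃ G.toSimpleGraphInclusive.ConnectedComponent,
    (∀ i j, i < j → ∃ x ∈ (c i).supp, ∀ y ∈ (c j).supp, x < y) ∧
    ∀ i, ∃ B : Digraph (Fin (k i + 1)), B.IsAlternating ∧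
      ∃ φ : Fin (k i + 1) ≃ (c i).supp, ∀ a b, B.Adj a b ↔ G.Adj (φ a) (φ b)

end Linear

end Digraph

/-! Let `E i` be the edge of `L` between `v_i` and `v_{i+1}`. Two consecutive edges cannot lie in
one multipath exactly when they share a source or a target, that is, when they point in opposite
directions (`IsConflict`). A linear graph has no cycles, so this is the only obstruction: multipaths
are the sets of edges without consecutive conflicting pairs (`IsOrientedLinear.isMultipath_eq`), the
independent sets of a disjoint union of path graphs.

The cohomology of such a family is computed by removing edges from the right end. If the last edge
conflicts with nothing, the family is a cone and is acyclic (`isAcyclicAt_of_cone`). If it conflicts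
with its neighbour `b`, the sets avoiding `b` form a cone over the last edge, so the cohomology is
that of the link of `b`, shifted by one (`exists_cocycle_link`, `extend_mem_coboundaries_iff`). The
link is again a family of the same kind on fewer edges. Hence the total cohomology has dimension at
most one, in the degree given by the recursion `bettiDegree` (`isConcentrated_sequenceFamily`). A
run of `p` mutually alternating edges lowers to `p - 3` with shift one: it is acyclic for `p ≡ 1`
mod 3 and otherwise lives in degree `⌊(p+1)/3⌋`. Degrees of successive runs add (`bettiDegree_add`).

An edge is deleted in the reduction exactly when it continues into the next edge
(`IsOrientedLinear.reduction_adj_iff`). So a component `A_k` other than the last one, together with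
the deleted edge after it, is a run of `k + 1` edges: acyclic if `k ≡ 0` mod 3, otherwise in degree
`⌊k/3⌋ + 1`. The graph `A_{3⌊k/3⌋}` has degree `⌊k/3⌋`; the extra ones produce the shift by `h - 1`.
The last component is a run of `k_h` edges. Both sides of the isomorphism are then zero or
one-dimensional in the same degree.

If `D(2)` fails, some edge conflicts with neither neighbour, so the family is a cone. -/

namespace Digraph

/-! ### Cochains on families of edge sets: cones and links. -/

section SetFamily

variable {V : Type v} [Fintype V] [LinearOrder V] (K : Type u) [Field K]

set_option linter.unusedSectionVars false

theorem coverSign_mul_self (H : Finset (V × V)) (e : V × V) :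
    coverSign K H e * coverSign K H e = 1 := by
  unfold coverSign
  rw [← mul_pow]
  simp

theorem coverSign_mul_coverSign_erase {H : Finset (V × V)} {a b : V × V} (ha : a ∈ H)
    (hb : b ∈ H) (hab : a ≠ b) :
    coverSign K H a * coverSign K (H.erase a) b =
      -(coverSign K H b * coverSign K (H.erase b) a) := by
  rcases lt_or_gt_of_ne (fun h : toLex a = toLex b => hab (toLex.injective h)) with h | h
  · rw [coverSign_erase_of_lt K ha h, coverSign_erase_of_gt K h]
    ring
  · rw [coverSign_erase_of_lt K hb h, coverSign_erase_of_gt K h]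
    ring

/-- The coboundary operator of a family `P` of finite sets of edges, acting on all functions. -/
noncomputable def coboundary (P : Finset (V × V) → Prop) :
    (Finset (V × V) → K) →ₗ[K] (Finset (V × V) → K) where
  toFun f H := by
    classical exact if P H then ∑ e ∈ H, coverSign K H e * f (H.erase e) else 0
  map_add' f g := by
    funext H
    by_cases h : P H <;> simp [h, mul_add, Finset.sum_add_distrib]
  map_smul' a f := by
    funext H
    by_cases h : P H <;> simp [h, Finset.mul_sum, mul_left_comm]

variable {K}

theorem coboundary_of_mem {P : Finset (V × V) → Prop} {f : Finset (V × V) → K}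
    {H : Finset (V × V)} (h : P H) :
    coboundary K P f H = ∑ e ∈ H, coverSign K H e * f (H.erase e) := by
  simp [coboundary, h]

theorem coboundary_of_notMem {P : Finset (V × V) → Prop} {f : Finset (V × V) → K}
    {H : Finset (V × V)} (h : ¬ P H) : coboundary K P f H = 0 := by
  simp [coboundary, h]

variable (K)

/-- The functions supported on the members of `P` with `d` elements. -/
def cochains (P : Finset (V × V) → Prop) (d : ℤ) : Submodule K (Finset (V × V) → K) where
  carrier := {f | ∀ H, f H ≠ 0 → P H ∧ (H.card : ℤ) = d}
  add_mem' := by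
    intro f g hf hg H hH
    by_cases h : f H = 0
    · exact hg H (by simpa [h] using hH)
    · exact hf H h
  zero_mem' := by simp
  smul_mem' := by
    intro a f hf H hH
    exact hf H (by aesop)

/-- The cocycles of degree `d` of a family of finite sets of edges. -/
noncomputable def cocycles (P : Finset (V × V) → Prop) (d : ℤ) : Submodule K (Finset (V × V) → K) :=
  cochains K P d ⊓ LinearMap.ker (coboundary K P)

/-- The coboundaries of degree `d` of a family of finite sets of edges. -/
noncomputable def coboundaries (P : Finset (V × V) → Prop) (d : ℤ) : Submodule K (Finset (V × V) → K) :=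
  (cochains K P (d - 1)).map (coboundary K P)

/-- The cohomology of `P` vanishes in degree `d`. -/
def IsAcyclicAt (P : Finset (V × V) → Prop) (d : ℤ) : Prop :=
  cocycles K P d ≤ coboundaries K P d

/-- The cohomology of `P` in degree `d` is one-dimensional. -/
def IsLineAt (P : Finset (V × V) → Prop) (d : ℤ) : Prop :=
  ∃ z ∈ cocycles K P d, z ∉ coboundaries K P d ∧
    ∀ w ∈ cocycles K P d, ∃ a : K, w - a • z ∈ coboundaries K P d

variable {K}

theorem coboundary_coboundary {P : Finset (V × V) → Prop} (hP : ∀ H e, P H → P (H.erase e))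
    (f : Finset (V × V) → K) : coboundary K P (coboundary K P f) = 0 := by
  funext H
  by_cases hH : P H
  swap
  · exact coboundary_of_notMem hH
  rw [coboundary_of_mem hH, Pi.zero_apply]
  have step : ∀ e ∈ H, coverSign K H e * coboundary K P f (H.erase e) =
      ∑ b ∈ H.erase e, coverSign K H e * (coverSign K (H.erase e) b * f ((H.erase e).erase b)) := by
    intro e _
    rw [coboundary_of_mem (hP H e hH), Finset.mul_sum]
  rw [Finset.sum_congr rfl step, Finset.sum_sigma']
  -- Deleting two edges in either order gives the same set with opposite signs, so the terms cancel
  -- in pairs.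
  refine Finset.sum_involution (fun x _ => ⟨x.2, x.1⟩) ?_ ?_ ?_ ?_
  · rintro ⟨a, b⟩ hx
    simp only [Finset.mem_sigma, Finset.mem_erase] at hx
    obtain ⟨ha, hba, hb⟩ := hx
    simp only
    rw [Finset.erase_right_comm (a := b) (b := a), ← mul_assoc, ← mul_assoc,
      coverSign_mul_coverSign_erase K ha hb (Ne.symm hba)]
    ring
  · rintro ⟨a, b⟩ hx _ h
    simp only [Finset.mem_sigma, Finset.mem_erase] at hx
    simp only [Sigma.mk.injEq] at h
    exact hx.2.1 h.1
  · rintro ⟨a, b⟩ hx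
    simp only [Finset.mem_sigma, Finset.mem_erase] at hx ⊢
    exact ⟨hx.2.2, fun h => hx.2.1 h.symm, hx.1⟩
  · rintro ⟨a, b⟩ _
    rfl

theorem coboundary_mem_cochains {P : Finset (V × V) → Prop} {d : ℤ} {f : Finset (V × V) → K}
    (hf : f ∈ cochains K P d) : coboundary K P f ∈ cochains K P (d + 1) := by
  intro H hH
  by_cases hPH : P H
  · refine ⟨hPH, ?_⟩
    rw [coboundary_of_mem hPH] at hH
    obtain ⟨e, he, hne⟩ := Finset.exists_ne_zero_of_sum_ne_zero hH
    have h1 := (hf _ (right_ne_zero_of_mul hne)).2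
    have := Finset.card_erase_add_one he
    omega
  · exact absurd (coboundary_of_notMem hPH) hH

/-- Contraction of cochains with an edge `a`. -/
def contract (a : V × V) (f : Finset (V × V) → K) : Finset (V × V) → K :=
  fun H => if a ∈ H then 0 else coverSign K (insert a H) a * f (insert a H)

/-- Extension of cochains of the link of `b`. -/
def extend (b : V × V) (f : Finset (V × V) → K) : Finset (V × V) → K :=
  fun H => if b ∈ H then coverSign K H b * f (H.erase b) else 0

/-- Contraction with the apex of a cone is a homotopy from the identity to zero. At a set without
`a`, the value of `f` is recovered by expanding the cocycle condition at `insert a H`. -/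
theorem coboundary_contract {P : Finset (V × V) → Prop} {a : V × V}
    (ha : ∀ H, P H → P (insert a H)) {d : ℤ} {f : Finset (V × V) → K}
    (hf : f ∈ cocycles K P d) : coboundary K P (contract a f) = f := by
  obtain ⟨hf, hz⟩ := hf
  funext H
  by_cases hH : P H
  swap
  · rw [coboundary_of_notMem hH]
    by_contra h
    exact hH (hf H (Ne.symm h)).1
  rw [coboundary_of_mem hH]
  by_cases haH : a ∈ H
  · rw [Finset.sum_eq_single a]
    · simp only [contract, Finset.notMem_erase, if_false, Finset.insert_erase haH]
      rw [← mul_assoc, coverSign_mul_self, one_mul]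
    · intro b _ hb
      simp [contract, haH, hb.symm]
    · exact fun h => absurd haH h
  · have h0 : coboundary K P f (insert a H) = 0 := congrFun hz _
    rw [coboundary_of_mem (ha H hH), Finset.sum_insert haH, Finset.erase_insert haH] at h0
    have h1 : f H = -∑ e ∈ H, coverSign K (insert a H) a *
        (coverSign K (insert a H) e * f ((insert a H).erase e)) := by
      rw [← Finset.mul_sum, eq_neg_iff_add_eq_zero]
      have := congrArg (fun x => coverSign K (insert a H) a * x) h0
      simpa only [mul_add, ← mul_assoc, coverSign_mul_self, one_mul, mul_zero] using this
    rw [h1, ← Finset.sum_neg_distrib]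
    refine Finset.sum_congr rfl fun e he => ?_
    have hea : a ≠ e := fun h => haH (h ▸ he)
    have haE : a ∉ H.erase e := fun h => haH (Finset.mem_of_mem_erase h)
    have key := coverSign_mul_coverSign_erase K (H := insert a H) (a := a) (b := e)
      (Finset.mem_insert_self _ _) (Finset.mem_insert_of_mem he) hea
    rw [Finset.erase_insert haH] at key
    have h2 := coverSign_mul_self K (insert a H) a
    have h3 := coverSign_mul_self K (insert a H) e
    simp only [contract, haE, if_false]
    have h4 : insert a (H.erase e) = (insert a H).erase e := by
      rw [Finset.erase_insert_of_ne hea]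
    rw [h4]
    have h5 := coverSign_mul_self K ((insert a H).erase e) a
    -- The anticommutation sign rule `key`, rearranged using that each sign squares to one.
    have h6 : coverSign K H e * coverSign K ((insert a H).erase e) a =
        -(coverSign K (insert a H) a * coverSign K (insert a H) e) := by
      generalize coverSign K (insert a H) a = A at *
      generalize coverSign K (insert a H) e = B at *
      generalize coverSign K ((insert a H).erase e) a = C at *
      generalize coverSign K H e = D at *
      calc D * C = A * A * (D * C) := by rw [h2, one_mul]
        _ = A * (A * D) * C := by ring
        _ = -(A * B) * (C * C) := by rw [key]; ring
        _ = _ := by rw [h5, mul_one]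
    rw [← mul_assoc, h6]
    ring

theorem contract_mem {P Q : Finset (V × V) → Prop} {a : V × V}
    (ha : ∀ H, a ∉ H → P (insert a H) → Q H) {d : ℤ} {f : Finset (V × V) → K}
    (hf : f ∈ cochains K P d) : contract a f ∈ cochains K Q (d - 1) := by
  intro H hH
  by_cases haH : a ∈ H
  · simp [contract, haH] at hH
  · simp only [contract, haH, if_false] at hH
    obtain ⟨h1, h2⟩ := hf _ (right_ne_zero_of_mul hH)
    rw [Finset.card_insert_of_notMem haH] at h2
    push_cast at h2
    exact ⟨ha H haH h1, by omega⟩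

/-- A family which is a cone is acyclic. -/
theorem isAcyclicAt_of_cone {P : Finset (V × V) → Prop} (hP : ∀ H e, P H → P (H.erase e))
    {a : V × V} (ha : ∀ H, P H → P (insert a H)) (d : ℤ) : IsAcyclicAt K P d := by
  intro f hf
  refine ⟨contract a f, contract_mem (fun H haH h => ?_) hf.1, coboundary_contract ha hf⟩
  simpa [Finset.erase_insert haH] using hP _ a h

theorem extend_mem {P : Finset (V × V) → Prop} {b : V × V} {d : ℤ} {f : Finset (V × V) → K}
    (hf : f ∈ cochains K (fun H => b ∉ H ∧ P (insert b H)) d) :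
    extend b f ∈ cochains K P (d + 1) := by
  intro H hH
  by_cases hb : b ∈ H
  · simp only [extend, hb, if_true] at hH
    obtain ⟨⟨_, h1⟩, h2⟩ := hf _ (right_ne_zero_of_mul hH)
    rw [Finset.insert_erase hb] at h1
    have := Finset.card_erase_add_one hb
    exact ⟨h1, by omega⟩
  · simp [extend, hb] at hH

/-- Exchanging the deletion of `b` with that of another edge costs a sign, so extension from the
link anticommutes with the coboundary. -/
theorem coboundary_extend (P : Finset (V × V) → Prop) (b : V × V) (f : Finset (V × V) → K) :
    coboundary K P (extend b f) =
      extend b (-coboundary K (fun H => b ∉ H ∧ P (insert b H)) f) := by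
  funext H
  by_cases hH : P H
  swap
  · rw [coboundary_of_notMem hH]
    by_cases hb : b ∈ H
    · simp only [extend, hb, if_true, Pi.neg_apply]
      rw [coboundary_of_notMem]
      · simp
      · rw [Finset.insert_erase hb]
        exact fun h => hH h.2
    · simp [extend, hb]
  rw [coboundary_of_mem hH]
  by_cases hb : b ∈ H
  · simp only [extend, hb, if_true, Pi.neg_apply]
    rw [coboundary_of_mem (by simpa [Finset.insert_erase hb] using hH), mul_neg, Finset.mul_sum,
      ← Finset.sum_neg_distrib, ← Finset.add_sum_erase _ _ hb]
    simp only [Finset.notMem_erase, if_false, mul_zero, zero_add]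
    refine Finset.sum_congr rfl fun e he => ?_
    obtain ⟨hne, heH⟩ := Finset.mem_erase.1 he
    rw [if_pos (Finset.mem_erase.2 ⟨hne.symm, hb⟩), ← mul_assoc,
      coverSign_mul_coverSign_erase K heH hb hne, Finset.erase_right_comm]
    ring
  · simp [extend, hb]

theorem extend_contract {b : V × V} {f : Finset (V × V) → K} (hf : ∀ H, b ∉ H → f H = 0) :
    extend b (contract b f) = f := by
  funext H
  by_cases hb : b ∈ H
  · simp only [extend, contract, hb, if_true, Finset.notMem_erase, if_false,
      Finset.insert_erase hb]
    rw [← mul_assoc, coverSign_mul_self, one_mul]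
  · simp [extend, hb, hf H hb]

theorem contract_extend {b : V × V} {f : Finset (V × V) → K} (hf : ∀ H, b ∈ H → f H = 0) :
    contract b (extend b f) = f := by
  funext H
  by_cases hb : b ∈ H
  · simp [contract, hb, hf H hb]
  · simp only [extend, contract, hb, if_false, Finset.mem_insert_self, if_true,
      Finset.erase_insert hb]
    rw [← mul_assoc, coverSign_mul_self, one_mul]

section Leaf

variable {P : Finset (V × V) → Prop} (hP : ∀ H e, P H → P (H.erase e)) {a b : V × V}
  (hab : a ≠ b) (hcone : ∀ H, P H → b ∉ H → P (insert a H))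

include hP hab hcone

/-- The part of `g` on sets avoiding `b` is a cocycle of a cone with apex `a`, hence a coboundary
there. Subtracting that coboundary leaves a cochain supported on sets containing `b`, which comes
from the link. Only closedness off `b` is assumed, so that the lemma applies both to cocycles and to
primitives of extended cochains. -/
theorem exists_sub_coboundary_eq_extend {d : ℤ} {g : Finset (V × V) → K}
    (hg : g ∈ cochains K P d) (hz : ∀ H, b ∉ H → coboundary K P g H = 0) :
    ∃ h ∈ cochains K P (d - 1), ∃ w ∈ cochains K (fun H => b ∉ H ∧ P (insert b H)) (d - 1),
      g - coboundary K P h = extend b w := by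
  let P₀ : Finset (V × V) → Prop := fun H => P H ∧ b ∉ H
  let g₀ : Finset (V × V) → K := fun H => if b ∈ H then 0 else g H
  have hg₀ : g₀ ∈ cocycles K P₀ d := by
    refine ⟨fun H hH => ?_, ?_⟩
    · by_cases hb : b ∈ H
      · simp [g₀, hb] at hH
      · simp only [g₀, hb, if_false] at hH
        exact ⟨⟨(hg H hH).1, hb⟩, (hg H hH).2⟩
    · rw [SetLike.mem_coe, LinearMap.mem_ker]
      funext H
      by_cases h₀ : P₀ H
      · rw [coboundary_of_mem h₀, Pi.zero_apply, ← hz H h₀.2, coboundary_of_mem h₀.1]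
        refine Finset.sum_congr rfl fun e _ => ?_
        simp [g₀, h₀.2]
      · exact coboundary_of_notMem h₀
  have hc : ∀ H, P₀ H → P₀ (insert a H) := fun H hH =>
    ⟨hcone H hH.1 hH.2, by simp [hab.symm, hH.2]⟩
  have key := coboundary_contract hc hg₀
  have hmem : contract a g₀ ∈ cochains K P (d - 1) := by
    refine contract_mem (fun H haH h => ?_) hg₀.1
    simpa [Finset.erase_insert haH] using hP _ a h.1
  have hoff : ∀ H, b ∉ H → (g - coboundary K P (contract a g₀)) H = 0 := by
    intro H hb
    by_cases hH : P H
    · have h1 := congrFun key H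
      rw [coboundary_of_mem ⟨hH, hb⟩] at h1
      rw [Pi.sub_apply, coboundary_of_mem hH, h1]
      simp [g₀, hb]
    · rw [Pi.sub_apply, coboundary_of_notMem hH, sub_zero]
      by_contra h
      exact hH (hg H h).1
  have hd : g - coboundary K P (contract a g₀) ∈ cochains K P d := by
    have := coboundary_mem_cochains hmem
    rw [sub_add_cancel] at this
    exact Submodule.sub_mem _ hg this
  exact ⟨contract a g₀, hmem, contract b (g - coboundary K P (contract a g₀)),
    contract_mem (fun H hb h => ⟨hb, h⟩) hd, (extend_contract hoff).symm⟩

/-- Surjectivity of the map from the cohomology of the link, in degree `d`, to that of `P`, in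
degree `d + 1`. -/
theorem exists_cocycle_link {d : ℤ} {z : Finset (V × V) → K} (hz : z ∈ cocycles K P (d + 1)) :
    ∃ w ∈ cocycles K (fun H => b ∉ H ∧ P (insert b H)) d,
      z - extend b w ∈ coboundaries K P (d + 1) := by
  obtain ⟨h, hh, w, hw, e⟩ := exists_sub_coboundary_eq_extend hP hab hcone hz.1
    (fun H _ => congrFun hz.2 H)
  rw [add_sub_cancel_right] at hw
  refine ⟨w, ⟨hw, ?_⟩, h, hh, by rw [← e]; abel⟩
  have h1 : coboundary K P (extend b w) = 0 := by
    rw [← e, map_sub, coboundary_coboundary hP, sub_zero]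
    exact hz.2
  rw [coboundary_extend] at h1
  have h2 := contract_extend (K := K) (b := b)
    (f := -coboundary K (fun H => b ∉ H ∧ P (insert b H)) w) (fun H hb => by
      rw [Pi.neg_apply, coboundary_of_notMem (fun h => h.1 hb), neg_zero])
  rw [h1] at h2
  rw [SetLike.mem_coe, LinearMap.mem_ker, ← neg_eq_zero, ← h2]
  funext H
  simp [contract]

/-- Well-definedness and injectivity of the same map. For injectivity, a primitive of `extend b w`
is closed off `b`, so it can itself be moved into the link. -/
theorem extend_mem_coboundaries_iff {d : ℤ} {w : Finset (V × V) → K}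
    (hw : w ∈ cochains K (fun H => b ∉ H ∧ P (insert b H)) d) :
    extend b w ∈ coboundaries K P (d + 1) ↔
      w ∈ coboundaries K (fun H => b ∉ H ∧ P (insert b H)) d := by
  constructor
  · rintro ⟨g, hg, e⟩
    obtain ⟨h, hh, u, hu, e'⟩ := exists_sub_coboundary_eq_extend hP hab hcone hg (fun H hb => by
      rw [e]; simp [extend, hb])
    rw [add_sub_cancel_right] at hu
    refine ⟨-u, Submodule.neg_mem _ hu, ?_⟩
    rw [map_neg]
    have h1 := coboundary_extend P b u
    rw [← e', map_sub, coboundary_coboundary hP, sub_zero, e] at h1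
    have h2 := contract_extend (K := K) (b := b) (f := w) (fun H hb => by
      by_contra h
      exact (hw H h).1.1 hb)
    rw [← h2, h1]
    refine (contract_extend fun H hb => ?_).symm
    rw [Pi.neg_apply, coboundary_of_notMem (fun h => h.1 hb), neg_zero]
  · rintro ⟨u, hu, rfl⟩
    have h1 := extend_mem hu
    refine ⟨extend b (-u), ?_, ?_⟩
    · rw [add_sub_cancel_right]
      rw [← sub_add_cancel d 1]
      exact extend_mem (Submodule.neg_mem _ hu)
    · rw [coboundary_extend, map_neg, neg_neg]

theorem isAcyclicAt_of_link {d : ℤ} (h : IsAcyclicAt K (fun H => b ∉ H ∧ P (insert b H)) d) :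
    IsAcyclicAt K P (d + 1) := by
  intro z hz
  obtain ⟨w, hw, hzw⟩ := exists_cocycle_link hP hab hcone hz
  have := (extend_mem_coboundaries_iff hP hab hcone hw.1).2 (h hw)
  simpa using Submodule.add_mem _ hzw this

theorem isLineAt_of_link {d : ℤ} (h : IsLineAt K (fun H => b ∉ H ∧ P (insert b H)) d) :
    IsLineAt K P (d + 1) := by
  obtain ⟨w, hw, hnot, hall⟩ := h
  refine ⟨extend b w, ⟨extend_mem hw.1, ?_⟩,
    fun h => hnot ((extend_mem_coboundaries_iff hP hab hcone hw.1).1 h), fun z hz => ?_⟩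
  · rw [SetLike.mem_coe, LinearMap.mem_ker, coboundary_extend, LinearMap.mem_ker.1 hw.2, neg_zero]
    funext H
    simp [extend]
  · obtain ⟨w', hw', hzw⟩ := exists_cocycle_link hP hab hcone hz
    obtain ⟨a, ha⟩ := hall w' hw'
    refine ⟨a, ?_⟩
    have h1 := (extend_mem_coboundaries_iff hP hab hcone
      (Submodule.sub_mem _ hw'.1 (Submodule.smul_mem _ a hw.1))).2 ha
    have h2 : extend b (w' - a • w) = extend b w' - a • extend b w := by
      funext H
      by_cases hb : b ∈ H
      · simp only [extend, hb, if_true, Pi.sub_apply, Pi.smul_apply, smul_eq_mul]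
        ring
      · simp [extend, hb]
    rw [h2] at h1
    simpa using Submodule.add_mem _ hzw h1

end Leaf

end SetFamily

end Digraph

/-! ### Families on a sequence of edges with consecutive conflicts. -/

namespace Digraph

section SequenceFamily

variable {V : Type v} [Fintype V] [LinearOrder V] (K : Type u) [Field K]

set_option linter.unusedSectionVars false

/-- The cohomology of `P` is one-dimensional and concentrated in degree `δ`, or vanishes. -/
def IsConcentrated (P : Finset (V × V) → Prop) (δ : Option ℕ) : Prop :=
  (∀ k : ℕ, δ = some k → IsLineAt K P k) ∧
    ∀ d : ℤ, (∀ k : ℕ, δ = some k → d ≠ k) → IsAcyclicAt K P d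

variable {K}

theorem isConcentrated_none_of_cone {P : Finset (V × V) → Prop}
    (hP : ∀ H e, P H → P (H.erase e)) {a : V × V} (ha : ∀ H, P H → P (insert a H)) :
    IsConcentrated K P none :=
  ⟨fun k hk => by simp at hk, fun d _ => isAcyclicAt_of_cone hP ha d⟩

theorem IsConcentrated.of_link {P : Finset (V × V) → Prop}
    (hP : ∀ H e, P H → P (H.erase e)) {a b : V × V} (hab : a ≠ b)
    (hcone : ∀ H, P H → b ∉ H → P (insert a H)) {δ : Option ℕ}
    (h : IsConcentrated K (fun H => b ∉ H ∧ P (insert b H)) δ) :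
    IsConcentrated K P (δ.map (· + 1)) := by
  constructor
  · intro k hk
    obtain ⟨j, hj, rfl⟩ := Option.map_eq_some_iff.1 hk
    have := isLineAt_of_link hP hab hcone (h.1 j hj)
    exact_mod_cast this
  · intro d hd
    rw [← sub_add_cancel d 1]
    refine isAcyclicAt_of_link hP hab hcone (h.2 _ fun k hk e => ?_)
    refine hd (k + 1) (by simp [hk]) ?_
    push_cast
    omega

/-- The sets of edges among `E 0, …, E (m - 1)` that do not contain both `E i` and `E (i + 1)`
if `c i` holds. -/
def sequenceFamily (E : ℕ → V × V) (c : ℕ → Prop) (m : ℕ) (H : Finset (V × V)) : Prop :=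
  (∀ x ∈ H, ∃ i < m, x = E i) ∧ ∀ i, i + 1 < m → c i → E i ∈ H → E (i + 1) ∉ H

theorem sequenceFamily_erase {E : ℕ → V × V} {c : ℕ → Prop} {m : ℕ} (H : Finset (V × V))
    (e : V × V) (h : sequenceFamily E c m H) : sequenceFamily E c m (H.erase e) :=
  ⟨fun x hx => h.1 x (Finset.mem_of_mem_erase hx), fun i hi hc hE hE' =>
    h.2 i hi hc (Finset.mem_of_mem_erase hE) (Finset.mem_of_mem_erase hE')⟩

theorem sequenceFamily_insert {E : ℕ → V × V} {c : ℕ → Prop} {m : ℕ}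
    (hE : ∀ i j, i < m → j < m → E i = E j → i = j) {H : Finset (V × V)}
    (h : sequenceFamily E c m H) {j : ℕ} (hj : j < m)
    (h₁ : ∀ i, i + 1 = j → c i → E i ∉ H) (h₂ : j + 1 < m → c j → E (j + 1) ∉ H) :
    sequenceFamily E c m (insert (E j) H) := by
  refine ⟨fun x hx => ?_, fun i hi hc hx hx' => ?_⟩
  · rcases Finset.mem_insert.1 hx with rfl | hx
    · exact ⟨j, hj, rfl⟩
    · exact h.1 x hx
  · rcases Finset.mem_insert.1 hx with e | y <;> rcases Finset.mem_insert.1 hx' with e' | y'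
    · have := hE _ _ (by omega) hj e
      have := hE _ _ hi hj e'
      omega
    · have hij := hE _ _ (by omega) hj e
      subst hij
      exact h₂ hi hc y'
    · exact h₁ i (hE _ _ hi hj e') hc y
    · exact h.2 i hi hc y y'

/-- Fixing `E m` excludes `E (m + 1)`, and also `E (m - 1)` if that one conflicts with `E m`. The
number `q` counts the remaining edges in the two cases. -/
theorem sequenceFamily_link {E : ℕ → V × V} {c : ℕ → Prop} {m q : ℕ}
    (hE : ∀ i j, i < m + 2 → j < m + 2 → E i = E j → i = j) (hc : c m)
    (hq : (q = m ∧ ∀ i, i + 1 = m → ¬ c i) ∨ (q + 1 = m ∧ c q)) :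
    (fun H => E m ∉ H ∧ sequenceFamily E c (m + 2) (insert (E m) H)) = sequenceFamily E c q := by
  funext H
  refine propext ⟨?_, ?_⟩
  · rintro ⟨hb, h⟩
    refine ⟨fun x hx => ?_, fun i hi hci hx hx' => ?_⟩
    · obtain ⟨i, hi, rfl⟩ := h.1 x (Finset.mem_insert_of_mem hx)
      refine ⟨i, ?_, rfl⟩
      have h1 : i ≠ m := by rintro rfl; exact hb hx
      have h2 : i ≠ m + 1 := by
        rintro rfl
        exact h.2 m (by omega) hc (Finset.mem_insert_self _ _) (Finset.mem_insert_of_mem hx)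
      rcases hq with ⟨rfl, _⟩ | ⟨rfl, hcq⟩
      · omega
      · have h3 : i ≠ q := by
          rintro rfl
          exact h.2 i (by omega) hcq (Finset.mem_insert_of_mem hx) (Finset.mem_insert_self _ _)
        omega
    · exact h.2 i (by omega) hci (Finset.mem_insert_of_mem hx) (Finset.mem_insert_of_mem hx')
  · intro h
    have hnot : ∀ j, q ≤ j → j < m + 2 → E j ∉ H := by
      intro j hj hj' hx
      obtain ⟨i, hi, e⟩ := h.1 _ hx
      have := hE _ _ hj' (by omega) e
      omega
    refine ⟨hnot m (by omega) (by omega), ?_⟩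
    refine sequenceFamily_insert hE ⟨fun x hx => ?_, fun i hi hci hx hx' => ?_⟩ (by omega)
      (fun i hi hci hx => ?_) fun _ _ => hnot (m + 1) (by omega) (by omega)
    · obtain ⟨i, hi, rfl⟩ := h.1 x hx
      exact ⟨i, by omega, rfl⟩
    · by_cases hiq : i + 1 < q
      · exact h.2 i hiq hci hx hx'
      · exact hnot (i + 1) (by omega) (by omega) hx'
    · rcases hq with ⟨rfl, hn⟩ | ⟨rfl, hcq⟩
      · exact hn i hi hci
      · exact hnot i (by omega) (by omega) hx

open Classical in
/-- The degree in which the cohomology of `sequenceFamily E c m` is concentrated. -/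
noncomputable def bettiDegree (c : ℕ → Prop) : ℕ → Option ℕ
  | 0 => some 0
  | 1 => none
  | 2 => if c 0 then some 1 else none
  | m + 3 => if c (m + 1) then
      (if c m then (bettiDegree c m).map (· + 1) else (bettiDegree c (m + 1)).map (· + 1))
    else none

/-- The empty set is the only member, so the complex is `K` in degree 0. -/
theorem isConcentrated_sequenceFamily_zero (E : ℕ → V × V) (c : ℕ → Prop) :
    IsConcentrated K (sequenceFamily E c 0) (some 0) := by
  have hemp : ∀ H, sequenceFamily E c 0 H ↔ H = ∅ := by
    intro H
    constructor
    · intro h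
      by_contra hne
      obtain ⟨x, hx⟩ := Finset.nonempty_of_ne_empty hne
      obtain ⟨i, hi, _⟩ := h.1 x hx
      omega
    · rintro rfl
      exact ⟨by simp, by simp⟩
  have hcob : ∀ f : Finset (V × V) → K, coboundary K (sequenceFamily E c 0) f = 0 := by
    intro f
    funext H
    by_cases h : sequenceFamily E c 0 H
    · rw [coboundary_of_mem h, (hemp H).1 h]
      simp
    · exact coboundary_of_notMem h
  have hker : ∀ f : Finset (V × V) → K, f ∈ coboundaries K (sequenceFamily E c 0) 0 → f = 0 := by
    rintro f ⟨g, _, rfl⟩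
    exact hcob g
  constructor
  · intro k hk
    obtain rfl : 0 = k := by simpa using hk
    refine ⟨Pi.single ∅ 1, ⟨fun H hH => ?_, hcob _⟩, fun h => ?_, fun w hw => ⟨w ∅, ?_⟩⟩
    · obtain rfl : H = ∅ := by
        by_contra h
        simp [h] at hH
      exact ⟨(hemp ∅).2 rfl, by simp⟩
    · have := congrFun (hker _ h) ∅
      simp at this
    · have : w - w ∅ • (Pi.single ∅ 1 : Finset (V × V) → K) = 0 := by
        funext H
        by_cases h : H = ∅
        · subst h; simp
        · have : w H = 0 := by
            by_contra hne
            exact h ((hemp H).1 (hw.1 H hne).1)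
          simp [h, this]
      rw [this]
      exact Submodule.zero_mem _
  · intro d hd z hz
    have : z = 0 := by
      funext H
      by_contra hne
      obtain ⟨h1, h2⟩ := hz.1 H hne
      rw [(hemp H).1 h1] at h2
      exact hd 0 rfl (by simpa using h2.symm)
    rw [this]
    exact Submodule.zero_mem _

/-- The recursion defining `bettiDegree` follows the two reductions at the right end: `cone` when
the last edge is free of conflicts, `leaf` when it conflicts with its neighbour. -/
theorem isConcentrated_sequenceFamily (E : ℕ → V × V) (c : ℕ → Prop) (m : ℕ)
    (hE : ∀ i j, i < m → j < m → E i = E j → i = j) :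
    IsConcentrated K (sequenceFamily E c m) (bettiDegree c m) := by
  have cone : ∀ m, (∀ i j, i < m + 1 → j < m + 1 → E i = E j → i = j) →
      (∀ i, i + 1 = m → ¬ c i) → IsConcentrated K (sequenceFamily E c (m + 1)) none := by
    intro m hE hc
    exact isConcentrated_none_of_cone sequenceFamily_erase (a := E m) fun H h =>
      sequenceFamily_insert hE h (by omega) (fun i hi hci => absurd hci (hc i hi)) (by omega)
  have leaf : ∀ m q δ, (∀ i j, i < m + 2 → j < m + 2 → E i = E j → i = j) → c m →
      ((q = m ∧ ∀ i, i + 1 = m → ¬ c i) ∨ (q + 1 = m ∧ c q)) →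
      IsConcentrated K (sequenceFamily E c q) δ →
      IsConcentrated K (sequenceFamily E c (m + 2)) (δ.map (· + 1)) := by
    intro m q δ hE hc hq h
    -- Once `E m` is excluded, the last edge `E (m + 1)` has no conflict left and serves as apex.
    refine IsConcentrated.of_link sequenceFamily_erase (a := E (m + 1)) (b := E m)
      (fun e => ?_) (fun H hH hb => ?_) ?_
    · have := hE _ _ (by omega) (by omega) e
      omega
    · refine sequenceFamily_insert hE hH (by omega) (fun i hi _ => ?_) (by omega)
      obtain rfl : i = m := by omega
      exact hb
    · rw [sequenceFamily_link hE hc hq]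
      exact h
  induction m using Nat.strong_induction_on with
  | _ m ih =>
    match m, hE, ih with
    | 0, _, _ => simpa [bettiDegree] using isConcentrated_sequenceFamily_zero E c
    | 1, hE, _ => simpa [bettiDegree] using cone 0 hE (by omega)
    | 2, hE, ih =>
      by_cases h : c 0
      · simpa [bettiDegree, h] using leaf 0 0 _ hE h (Or.inl ⟨rfl, by omega⟩)
          (ih 0 (by omega) (by omega))
      · rw [bettiDegree, if_neg h]
        exact cone 1 hE (fun i hi => by obtain rfl : i = 0 := by omega
                                        exact h)
    | m + 3, hE, ih =>
      rw [bettiDegree]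
      by_cases h : c (m + 1)
      · rw [if_pos h]
        by_cases h' : c m
        · rw [if_pos h']
          exact leaf (m + 1) m _ hE h (Or.inr ⟨rfl, h'⟩)
            (ih m (by omega) fun i j hi hj => hE i j (by omega) (by omega))
        · rw [if_neg h']
          refine leaf (m + 1) (m + 1) _ hE h (Or.inl ⟨rfl, fun i hi => ?_⟩)
            (ih (m + 1) (by omega) fun i j hi hj => hE i j (by omega) (by omega))
          obtain rfl : i = m := by omega
          exact h'
      · rw [if_neg h]
        refine cone (m + 2) hE fun i hi => ?_
        obtain rfl : i = m + 1 := by omega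
        exact h

/-- The degree of the cohomology of an alternating graph with `p` edges. -/
def alternatingDegree (p : ℕ) : Option ℕ := if p % 3 = 1 then none else some ((p + 1) / 3)

/-- A Künneth rule: there is no conflict across position `s`, so the complex is a join. It is proved
through the recursion, which goes from `s + p + 3` to `s + p` with shift one inside an alternating
run; thus `p = 0, 1, 2` are the base cases. -/
theorem bettiDegree_add (c : ℕ → Prop) (s : ℕ) (hs : ∀ i, i + 1 = s → ¬ c i) (p : ℕ)
    (hc : ∀ i, s ≤ i → i + 1 < s + p → c i) :
    bettiDegree c (s + p) = (bettiDegree c s).bind fun x => (alternatingDegree p).map (x + ·) := by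
  induction p using Nat.strong_induction_on with
  | _ p ih =>
    match p, hc, ih with
    | 0, _, _ => simp [alternatingDegree]
    | 1, _, _ =>
      match s, hs with
      | 0, _ => simp [alternatingDegree, bettiDegree]
      | 1, hs => simp [alternatingDegree, bettiDegree, hs 0]
      | s + 2, hs => simp [alternatingDegree, bettiDegree, hs (s + 1)]
    | 2, hc, _ =>
      match s, hs with
      | 0, _ => simp [alternatingDegree, bettiDegree, hc 0]
      | s + 1, hs =>
        simp [alternatingDegree, bettiDegree, hc (s + 1), hs s]
        cases bettiDegree c (s + 1) <;> simp
    | p + 3, hc, ih =>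
      rw [← add_assoc, bettiDegree, if_pos (hc _ (by omega) (by omega)),
        if_pos (hc _ (by omega) (by omega)),
        ih p (by omega) fun i hi hi' => hc i hi (by omega)]
      have h1 : (p + 3) % 3 = p % 3 := by omega
      have h2 : (p + 3 + 1) / 3 = (p + 1) / 3 + 1 := by omega
      rw [alternatingDegree, alternatingDegree, h1, h2]
      cases bettiDegree c s <;> simp
      split_ifs <;> simp [add_assoc]

theorem bettiDegree_eq_alternatingDegree {c : ℕ → Prop} {m : ℕ} (hc : ∀ i, i + 1 < m → c i) :
    bettiDegree c m = alternatingDegree m := by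
  have := bettiDegree_add c 0 (by omega) m fun i _ hi => hc i (by omega)
  rw [zero_add] at this
  rw [this, bettiDegree]
  cases alternatingDegree m <;> simp

/-- The degree for a concatenation of alternating segments. -/
theorem bettiDegree_sum (c : ℕ → Prop) (k : ℕ → ℕ) (h : ℕ)
    (hc : ∀ j < h, ∀ i, ∑ l ∈ Finset.range j, (k l + 1) ≤ i →
      i < ∑ l ∈ Finset.range j, (k l + 1) + k j → c i)
    (hn : ∀ j < h, ¬ c (∑ l ∈ Finset.range j, (k l + 1) + k j)) (p : ℕ)
    (hp : ∀ i, ∑ l ∈ Finset.range h, (k l + 1) ≤ i →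
      i + 1 < ∑ l ∈ Finset.range h, (k l + 1) + p → c i) :
    ((∃ j < h, k j % 3 = 0) →
      bettiDegree c (∑ l ∈ Finset.range h, (k l + 1) + p) = none) ∧
    ((¬ ∃ j < h, k j % 3 = 0) → bettiDegree c (∑ l ∈ Finset.range h, (k l + 1) + p) =
      (alternatingDegree p).map (∑ l ∈ Finset.range h, (k l / 3 + 1) + ·)) := by
  induction h generalizing p with
  | zero =>
    refine ⟨by simp, fun _ => ?_⟩
    rw [Finset.sum_range_zero, zero_add,
      bettiDegree_eq_alternatingDegree fun i hi => hp i (by simp) (by simpa using hi)]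
    simp
  | succ h ih =>
    -- The block of index `h` is no longer last, so it now contributes `k h + 1` edges, including
    -- the one that ends at no conflict.
    have h0 := ih (fun j hj => hc j (by omega)) (fun j hj => hn j (by omega)) (k h + 1)
      (fun i hi hi' => hc h (by omega) i hi (by omega))
    have hs : ∀ i, i + 1 = ∑ l ∈ Finset.range (h + 1), (k l + 1) → ¬ c i := by
      intro i hi
      rw [Finset.sum_range_succ, ← add_assoc] at hi
      have := hn h (by omega)
      rwa [← Nat.succ_injective hi] at this
    have key := bettiDegree_add c _ hs p hp
    rw [key]
    rw [Finset.sum_range_succ] at *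
    constructor
    · rintro ⟨j, hj, hj0⟩
      by_cases hex : ∃ j < h, k j % 3 = 0
      · rw [h0.1 hex]; rfl
      · obtain rfl : j = h := by
          by_contra hne
          exact hex ⟨j, by omega, hj0⟩
        rw [h0.2 hex, alternatingDegree, if_pos (by omega)]
        rfl
    · intro hex
      have hh : k h % 3 ≠ 0 := fun e => hex ⟨h, by omega, e⟩
      rw [h0.2 fun ⟨j, hj, e⟩ => hex ⟨j, by omega, e⟩, alternatingDegree, if_neg (by omega),
        Finset.sum_range_succ]
      -- This uses that `k h` is not divisible by 3.
      have : (k h + 1 + 1) / 3 = k h / 3 + 1 := by omega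
      simp [this]

end SequenceFamily

end Digraph

/-! ### Elementwise criteria for homology of dimension zero or one. -/

section ModuleCat

variable {K : Type u} [Field K]

theorem CategoryTheory.ShortComplex.subsingleton_moduleCat_homology
    (S : ShortComplex (ModuleCat.{v} K)) (h : ∀ x, S.g.hom x = 0 → ∃ y, S.f.hom y = x) :
    Subsingleton S.homology := by
  have e := S.moduleCatHomologyIso.toLinearEquiv
  have : Subsingleton (LinearMap.ker S.g.hom ⧸ LinearMap.range S.moduleCatToCycles) := by
    rw [Submodule.Quotient.subsingleton_iff, eq_top_iff]
    rintro ⟨x, hx⟩ -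
    obtain ⟨y, hy⟩ := h x hx
    exact ⟨y, Subtype.ext hy⟩
  exact e.toEquiv.subsingleton (β := LinearMap.ker S.g.hom ⧸ LinearMap.range S.moduleCatToCycles)

theorem CategoryTheory.ShortComplex.nonempty_moduleCat_homology_linearEquiv
    (S : ShortComplex (ModuleCat.{v} K)) (z : S.X₂) (hz : S.g.hom z = 0)
    (hn : ¬ ∃ y, S.f.hom y = z)
    (h : ∀ x, S.g.hom x = 0 → ∃ a : K, ∃ y, S.f.hom y = x - a • z) :
    Nonempty (S.homology ≃ₗ[K] K) := by
  let Q := LinearMap.ker S.g.hom ⧸ LinearMap.range S.moduleCatToCycles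
  let e : S.homology ≃ₗ[K] Q := S.moduleCatHomologyIso.toLinearEquiv
  let q : Q := Submodule.Quotient.mk ⟨z, hz⟩
  have hq : q ≠ 0 := by
    intro h0
    obtain ⟨y, hy⟩ := (Submodule.Quotient.mk_eq_zero _).1 h0
    exact hn ⟨y, congrArg Subtype.val hy⟩
  have key : Function.Bijective (LinearMap.toSpanSingleton K Q q) := by
    constructor
    · rw [← LinearMap.ker_eq_bot, LinearMap.ker_toSpanSingleton K hq]
    · intro y
      obtain ⟨⟨x, hx⟩, rfl⟩ := Submodule.Quotient.mk_surjective _ y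
      obtain ⟨a, y, hy⟩ := h x hx
      refine ⟨a, ?_⟩
      rw [LinearMap.toSpanSingleton_apply]
      have hmem : (⟨x, hx⟩ - a • ⟨z, hz⟩ : LinearMap.ker S.g.hom) ∈
          LinearMap.range S.moduleCatToCycles := ⟨y, Subtype.ext hy⟩
      exact ((Submodule.Quotient.eq _).2 hmem).symm
  exact ⟨e.trans (LinearEquiv.ofBijective _ key).symm⟩

end ModuleCat

/-! ### Comparison with the multipath complex. -/

namespace Digraph

section Comparison

variable {V : Type v} [Fintype V] [LinearOrder V] {K : Type u} [Field K]

set_option linter.unusedSectionVars false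

/-- Restriction of a function to the multipaths with `d` edges. -/
def restrictMultipath (G : Digraph V) (d : ℕ) (f : Finset (V × V) → K) :
    G.MultipathOfLength d → K := fun H => f H.1

open Classical in
/-- Extension by zero of a cochain of the multipath complex. -/
noncomputable def extendMultipath (G : Digraph V) (d : ℕ) (x : G.MultipathOfLength d → K) :
    Finset (V × V) → K := fun H => if h : G.IsMultipath H ∧ H.card = d then x ⟨H, h⟩ else 0

theorem restrictMultipath_extendMultipath (G : Digraph V) (d : ℕ)
    (x : G.MultipathOfLength d → K) :
    restrictMultipath G d (extendMultipath G d x) = x := by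
  funext H
  exact dif_pos H.2

theorem extendMultipath_mem (G : Digraph V) (d : ℕ) (x : G.MultipathOfLength d → K) :
    extendMultipath G d x ∈ cochains K G.IsMultipath d := by
  intro H hH
  by_cases h : G.IsMultipath H ∧ H.card = d
  · exact ⟨h.1, by exact_mod_cast h.2⟩
  · exact absurd (dif_neg h) hH

theorem eq_of_restrictMultipath_eq {G : Digraph V} {d : ℕ} {f g : Finset (V × V) → K}
    (hf : f ∈ cochains K G.IsMultipath d) (hg : g ∈ cochains K G.IsMultipath d)
    (h : restrictMultipath G d f = restrictMultipath G d g) : f = g := by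
  funext H
  by_cases hH : G.IsMultipath H ∧ H.card = d
  · exact congrFun h ⟨H, hH⟩
  · have : ∀ f ∈ cochains K G.IsMultipath (d : ℤ), f H = 0 := by
      intro f hf
      by_contra hne
      exact hH ⟨(hf H hne).1, by exact_mod_cast (hf H hne).2⟩
    rw [this f hf, this g hg]

theorem restrictMultipath_coboundary (G : Digraph V) (d : ℕ) (f : Finset (V × V) → K) :
    restrictMultipath G (d + 1) (coboundary K G.IsMultipath f) =
      multipathDifferential K G d (restrictMultipath G d f) := by
  funext H
  rw [restrictMultipath, coboundary_of_mem H.2.1, ← Finset.sum_attach]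
  rfl

theorem multipathDifferential_restrictMultipath_eq_zero_iff {G : Digraph V} {d : ℕ}
    {f : Finset (V × V) → K} (hf : f ∈ cochains K G.IsMultipath d) :
    multipathDifferential K G d (restrictMultipath G d f) = 0 ↔ f ∈ cocycles K G.IsMultipath d := by
  rw [← restrictMultipath_coboundary]
  constructor
  · intro h
    refine ⟨hf, ?_⟩
    have h1 := coboundary_mem_cochains hf
    exact eq_of_restrictMultipath_eq (d := d + 1) (by exact_mod_cast h1) (Submodule.zero_mem _) h
  · rintro ⟨_, h⟩
    rw [LinearMap.mem_ker.1 h]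
    rfl

theorem multipathComplex_d (G : Digraph V) (d : ℕ) :
    (multipathComplex K G).d d (d + 1) = ModuleCat.ofHom (multipathDifferential K G d) :=
  CochainComplex.of_d (fun d => ModuleCat.of K (G.MultipathOfLength d → K))
    (fun d => ModuleCat.ofHom (multipathDifferential K G d)) d

theorem multipathComplex_sc_g_eq_zero_iff (G : Digraph V) (d : ℕ)
    (x : G.MultipathOfLength d → K) :
    ((multipathComplex K G).sc d).g.hom x = 0 ↔ multipathDifferential K G d x = 0 := by
  have key : ∀ j, j = d + 1 → (((multipathComplex K G).d d j).hom x = 0 ↔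
      multipathDifferential K G d x = 0) := by
    rintro j rfl
    rw [multipathComplex_d]
    rfl
  exact key _ (CochainComplex.next ℕ d)

/-- In positive degree, restriction and extension by zero translate primitives. In degree 0 the
incoming map is zero, and so are the cochains of degree `-1`. -/
theorem multipathComplex_sc_f_exists_iff {G : Digraph V} {d : ℕ} {f : Finset (V × V) → K}
    (hf : f ∈ cochains K G.IsMultipath d) :
    (∃ y, ((multipathComplex K G).sc d).f.hom y = restrictMultipath G d f) ↔
      f ∈ coboundaries K G.IsMultipath d := by
  cases d with
  | zero =>
    have h0 : ((multipathComplex K G).sc 0).f = 0 :=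
      (multipathComplex K G).shape _ _ (by simp)
    constructor
    · rintro ⟨y, hy⟩
      rw [h0] at hy
      have : f = 0 := eq_of_restrictMultipath_eq hf (Submodule.zero_mem _) hy.symm
      rw [this]
      exact Submodule.zero_mem _
    · rintro ⟨g, hg, rfl⟩
      have : g = 0 := by
        funext H
        by_contra hne
        have := (hg H hne).2
        omega
      refine ⟨0, ?_⟩
      rw [this, map_zero, map_zero]
      rfl
  | succ d =>
    have key : ∀ i, i = d →
        ((∃ y, ((multipathComplex K G).d i (d + 1)).hom y = restrictMultipath G (d + 1) f) ↔
          ∃ y, multipathDifferential K G d y = restrictMultipath G (d + 1) f) := by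
      rintro i rfl
      rw [multipathComplex_d]
      rfl
    refine (key _ (CochainComplex.prev_nat_succ d)).trans ?_
    have hd : ((d + 1 : ℕ) : ℤ) - 1 = d := by push_cast; ring
    constructor
    · rintro ⟨y, hy⟩
      refine ⟨extendMultipath G d y, ?_, ?_⟩
      · rw [hd]
        exact extendMultipath_mem G d y
      · refine eq_of_restrictMultipath_eq (d := d + 1) ?_ hf ?_
        · exact_mod_cast coboundary_mem_cochains (extendMultipath_mem G d y)
        · rw [restrictMultipath_coboundary, restrictMultipath_extendMultipath, hy]
    · rintro ⟨g, hg, rfl⟩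
      exact ⟨restrictMultipath G d g, (restrictMultipath_coboundary G d g).symm⟩

theorem subsingleton_multipathCohomology {G : Digraph V} {d : ℕ}
    (h : IsAcyclicAt K G.IsMultipath d) : Subsingleton (G.multipathCohomology K d) := by
  refine ShortComplex.subsingleton_moduleCat_homology _
    fun (x : G.MultipathOfLength d → K) hx => ?_
  replace hx := (multipathComplex_sc_g_eq_zero_iff G d x).1 hx
  have hm := extendMultipath_mem G d x
  rw [← restrictMultipath_extendMultipath G d x,
    multipathDifferential_restrictMultipath_eq_zero_iff hm] at hx
  rw [← restrictMultipath_extendMultipath G d x]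
  exact (multipathComplex_sc_f_exists_iff hm).2 (h hx)

theorem nonempty_multipathCohomology_linearEquiv {G : Digraph V} {d : ℕ}
    (h : IsLineAt K G.IsMultipath d) : Nonempty (G.multipathCohomology K d ≃ₗ[K] K) := by
  obtain ⟨z, hz, hn, hall⟩ := h
  refine ShortComplex.nonempty_moduleCat_homology_linearEquiv _ (restrictMultipath G d z) ?_ ?_ ?_
  · rw [multipathComplex_sc_g_eq_zero_iff,
      multipathDifferential_restrictMultipath_eq_zero_iff hz.1]
    exact hz
  · rwa [multipathComplex_sc_f_exists_iff hz.1]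
  · intro (x : G.MultipathOfLength d → K) hx
    replace hx := (multipathComplex_sc_g_eq_zero_iff G d x).1 hx
    have hm := extendMultipath_mem G d x
    rw [← restrictMultipath_extendMultipath G d x,
      multipathDifferential_restrictMultipath_eq_zero_iff hm] at hx
    obtain ⟨a, ha⟩ := hall _ hx
    have := (multipathComplex_sc_f_exists_iff
      (Submodule.sub_mem _ hm (Submodule.smul_mem _ a hz.1))).2 ha
    refine ⟨a, ?_⟩
    have e : x - a • restrictMultipath G d z =
        restrictMultipath G d (extendMultipath G d x - a • z) := by
      conv_lhs => rw [← restrictMultipath_extendMultipath G d x]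
      rfl
    obtain ⟨y, hy⟩ := this
    exact ⟨y, hy.trans e.symm⟩

end Comparison

end Digraph

/-! ### Oriented linear graphs, their multipaths and simple paths. -/

namespace Digraph

section OrientedLinear

variable {n : ℕ} (L : Digraph (Fin (n + 1)))

/-- The edge between `v_i` and `v_{i+1}` points to `v_{i+1}`. -/
def IsRightward (i : ℕ) : Prop := ∃ h : i < n, L.Adj ⟨i, by omega⟩ ⟨i + 1, by omega⟩

/-- The edges at `v_{i+1}` have a common source or a common target. -/
def IsConflict (i : ℕ) : Prop := ¬ (L.IsRightward i ↔ L.IsRightward (i + 1))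

open Classical in
/-- The edge between `v_i` and `v_{i+1}`. -/
noncomputable def edgeAt (i : ℕ) : Fin (n + 1) × Fin (n + 1) :=
  if h : i < n then
    if L.IsRightward i then (⟨i, by omega⟩, ⟨i + 1, by omega⟩)
    else (⟨i + 1, by omega⟩, ⟨i, by omega⟩)
  else (0, 0)

variable {L}

theorem edgeAt_of_isRightward {i : ℕ} (h : i < n) (hr : L.IsRightward i) :
    L.edgeAt i = (⟨i, by omega⟩, ⟨i + 1, by omega⟩) := by
  rw [edgeAt, dif_pos h, if_pos hr]

theorem edgeAt_of_not_isRightward {i : ℕ} (h : i < n) (hr : ¬ L.IsRightward i) :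
    L.edgeAt i = (⟨i + 1, by omega⟩, ⟨i, by omega⟩) := by
  rw [edgeAt, dif_pos h, if_neg hr]

theorem eq_edgeAt_iff {i : ℕ} (h : i < n) (x : Fin (n + 1) × Fin (n + 1)) :
    x = L.edgeAt i ↔ (L.IsRightward i ∧ (x.1 : ℕ) = i ∧ (x.2 : ℕ) = i + 1) ∨
      (¬ L.IsRightward i ∧ (x.1 : ℕ) = i + 1 ∧ (x.2 : ℕ) = i) := by
  obtain ⟨a, b⟩ := x
  by_cases hr : L.IsRightward i
  · simp [edgeAt_of_isRightward h hr, hr, Fin.ext_iff]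
  · simp [edgeAt_of_not_isRightward h hr, hr, Fin.ext_iff]

theorem edgeAt_cases {i : ℕ} (h : i < n) :
    (L.IsRightward i ∧ ((L.edgeAt i).1 : ℕ) = i ∧ ((L.edgeAt i).2 : ℕ) = i + 1) ∨
      (¬ L.IsRightward i ∧ ((L.edgeAt i).1 : ℕ) = i + 1 ∧ ((L.edgeAt i).2 : ℕ) = i) :=
  (eq_edgeAt_iff h _).1 rfl

theorem edgeAt_injOn {i j : ℕ} (hi : i < n) (hj : j < n) (h : L.edgeAt i = L.edgeAt j) :
    i = j := by
  have h1 := edgeAt_cases (L := L) hi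
  have h2 := edgeAt_cases (L := L) hj
  rw [h] at h1
  omega

theorem IsOrientedLinear.adj_iff (hL : L.IsOrientedLinear) (a b : Fin (n + 1)) :
    L.Adj a b ↔ ((a : ℕ) + 1 = b ∧ L.IsRightward a) ∨ ((b : ℕ) + 1 = a ∧ ¬ L.IsRightward b) := by
  have right : ∀ a b : Fin (n + 1), (a : ℕ) + 1 = b → (L.IsRightward a ↔ L.Adj a b) := by
    intro a b hab
    have hb : b = ⟨a + 1, by omega⟩ := Fin.ext hab.symm
    rw [hb]
    exact ⟨fun ⟨_, h⟩ => h, fun h => ⟨by omega, h⟩⟩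
  constructor
  · intro h
    rcases hL.2 a b h with hab | hab
    · exact Or.inl ⟨hab, (right a b hab).2 h⟩
    · refine Or.inr ⟨hab, fun hr => ?_⟩
      have := hL.1 b a hab
      rcases this with ⟨_, h'⟩ | ⟨_, h'⟩
      · exact h' h
      · exact h' ((right b a hab).1 hr)
  · rintro (⟨hab, hr⟩ | ⟨hab, hr⟩)
    · exact (right a b hab).1 hr
    · rcases hL.1 b a hab with ⟨h', _⟩ | ⟨h', _⟩
      · exact absurd ((right b a hab).2 h') hr
      · exact h'

theorem IsOrientedLinear.adj_edgeAt (hL : L.IsOrientedLinear) {i : ℕ} (hi : i < n) :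
    L.Adj (L.edgeAt i).1 (L.edgeAt i).2 := by
  rw [hL.adj_iff]
  rcases edgeAt_cases (L := L) hi with ⟨h, h1, h2⟩ | ⟨h, h1, h2⟩
  · rw [h1, h2]; exact Or.inl ⟨rfl, h⟩
  · rw [h1, h2]; exact Or.inr ⟨rfl, h⟩

theorem IsOrientedLinear.exists_eq_edgeAt (hL : L.IsOrientedLinear)
    {x : Fin (n + 1) × Fin (n + 1)} (h : L.Adj x.1 x.2) : ∃ i < n, x = L.edgeAt i := by
  rcases (hL.adj_iff _ _).1 h with ⟨h1, h2⟩ | ⟨h1, h2⟩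
  · have hlt : (x.1 : ℕ) < n := by omega
    exact ⟨x.1, hlt, (eq_edgeAt_iff hlt x).2 (Or.inl ⟨h2, rfl, h1.symm⟩)⟩
  · have hlt : (x.2 : ℕ) < n := by omega
    exact ⟨x.2, hlt, (eq_edgeAt_iff hlt x).2 (Or.inr ⟨h2, h1.symm, rfl⟩)⟩

theorem IsOrientedLinear.exists_height (hL : L.IsOrientedLinear) :
    ∃ φ : Fin (n + 1) → ℕ, ∀ a b, L.Adj a b → φ a < φ b := by
  classical
  let N : ℕ → ℕ := fun v => ((Finset.range v).filter fun j => L.IsRightward j).card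
  have hN : ∀ v, N (v + 1) = N v + if L.IsRightward v then 1 else 0 := by
    intro v
    simp only [N, Finset.range_add_one, Finset.filter_insert]
    split_ifs <;> simp
  -- `N v` counts the rightward edges before `v`. Going from `v` to `v + 1`, the height changes by
  -- `-1 + 2` along a rightward edge and by `-1` along a leftward one, so it rises by one along
  -- every edge.
  refine ⟨fun v => n + 1 - v + 2 * N v, fun a b h => ?_⟩
  rcases (hL.adj_iff _ _).1 h with ⟨h1, h2⟩ | ⟨h1, h2⟩
  · have := hN a
    rw [if_pos h2, h1] at this
    have := b.2
    simp only
    omega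
  · have := hN b
    rw [if_neg h2, h1] at this
    have := a.2
    simp only
    omega

/-- By `isPathUnion_iff` only coinciding sources or targets can obstruct, the height function being
available for all of `L`. Non-consecutive edges share no vertex, and consecutive ones share a source
or target exactly when their directions differ. -/
theorem IsOrientedLinear.isMultipath_eq (hL : L.IsOrientedLinear) :
    L.IsMultipath = sequenceFamily L.edgeAt L.IsConflict n := by
  funext H
  refine propext ⟨?_, ?_⟩
  · rintro ⟨h1, h2⟩
    obtain ⟨hs, ht, _⟩ := isPathUnion_iff.1 h2
    refine ⟨fun x hx => hL.exists_eq_edgeAt (h1 x hx), fun i hi hc hx hy => ?_⟩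
    have e1 := edgeAt_cases (L := L) (i := i) (by omega)
    have e2 := edgeAt_cases (L := L) hi
    have hne : L.edgeAt i ≠ L.edgeAt (i + 1) := fun e => by
      have := edgeAt_injOn (by omega) hi e
      omega
    unfold IsConflict at hc
    by_cases hr : L.IsRightward i <;> by_cases hr' : L.IsRightward (i + 1) <;>
      simp only [hr, hr', not_true_eq_false, not_false_eq_true, false_and, true_and, or_false,
        false_or, iff_true, iff_false] at hc e1 e2
    · exact hne (ht _ hx _ hy (Fin.ext (by omega)))
    · exact hne (hs _ hx _ hy (Fin.ext (by omega)))
  · rintro ⟨h1, h2⟩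
    have hadj : ∀ e ∈ H, L.Adj e.1 e.2 := by
      intro e he
      obtain ⟨i, hi, rfl⟩ := h1 e he
      exact hL.adj_edgeAt hi
    have key : ∀ i j, i < j → j < n → L.edgeAt i ∈ H → L.edgeAt j ∈ H →
        (L.edgeAt i).1 ≠ (L.edgeAt j).1 ∧ (L.edgeAt i).2 ≠ (L.edgeAt j).2 := by
      intro i j hij hj hi' hj'
      have e1 := edgeAt_cases (L := L) (i := i) (by omega)
      have e2 := edgeAt_cases (L := L) hj
      rw [Fin.ne_iff_vne, Fin.ne_iff_vne]
      by_cases hs : j = i + 1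
      · subst hs
        have hc : ¬ L.IsConflict i := fun hc => h2 i hj hc hi' hj'
        unfold IsConflict at hc
        by_cases hr : L.IsRightward i <;> by_cases hr' : L.IsRightward (i + 1) <;>
          simp only [hr, hr', not_true_eq_false, not_false_eq_true, false_and, true_and, or_false,
            false_or, iff_true, iff_false] at hc e1 e2
        · omega
        · omega
      · omega
    have key' : ∀ e ∈ H, ∀ f ∈ H, e ≠ f → e.1 ≠ f.1 ∧ e.2 ≠ f.2 := by
      intro e he f hf hne
      obtain ⟨i, hi, rfl⟩ := h1 e he
      obtain ⟨j, hj, rfl⟩ := h1 f hf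
      rcases lt_trichotomy i j with h | h | h
      · exact key i j h hj he hf
      · exact absurd (by rw [h]) hne
      · exact ⟨(key j i h hi hf he).1.symm, (key j i h hi hf he).2.symm⟩
    obtain ⟨φ, hφ⟩ := hL.exists_height
    refine ⟨hadj, isPathUnion_iff.2 ⟨fun e he f hf h => ?_, fun e he f hf h => ?_,
      φ, fun e he => hφ _ _ (hadj e he)⟩⟩
    · by_contra hne
      exact (key' e he f hf hne).1 h
    · by_contra hne
      exact (key' e he f hf hne).2 h

theorem IsOrientedLinear.isConcentrated (hL : L.IsOrientedLinear) (K : Type u) [Field K] :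
    IsConcentrated K L.IsMultipath (bettiDegree L.IsConflict n) := by
  rw [hL.isMultipath_eq]
  exact isConcentrated_sequenceFamily _ _ _ fun _ _ => edgeAt_injOn

/-- If two consecutive vertices are not stable, then the multipath cohomology vanishes. -/
theorem IsOrientedLinear.isConcentrated_none (hL : L.IsOrientedLinear) (K : Type u) [Field K]
    {i : ℕ} (hi : i + 2 < n) (h : ¬ L.IsConflict i) (h' : ¬ L.IsConflict (i + 1)) :
    IsConcentrated K L.IsMultipath none := by
  rw [hL.isMultipath_eq]
  refine isConcentrated_none_of_cone sequenceFamily_erase (a := L.edgeAt (i + 1)) fun H hH =>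
    sequenceFamily_insert (fun _ _ => edgeAt_injOn) hH (by omega) (fun j hj hc => ?_)
      fun _ hc => absurd hc h'
  obtain rfl : j = i := by omega
  exact absurd hc h

section SimplePath

variable {m : ℕ} {p : Fin (m + 1) → Fin (n + 1) × Fin (n + 1)}

/-- A composable sequence cannot turn back, since no pair of vertices is joined in both directions;
it therefore runs steadily to the right or to the left. -/
theorem IsOrientedLinear.composable_cases (hL : L.IsOrientedLinear)
    (hadj : ∀ t, L.Adj (p t).1 (p t).2)
    (hcomp : ∀ t : Fin m, (p t.castSucc).2 = (p t.succ).1) :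
    (∀ t : Fin (m + 1), ((p t).1 : ℕ) = (p 0).1 + t ∧ ((p t).2 : ℕ) = (p 0).1 + t + 1) ∨
      ∀ t : Fin (m + 1), ((p t).1 : ℕ) + t = (p 0).1 ∧ ((p t).2 : ℕ) + t + 1 = (p 0).1 := by
  rcases (hL.adj_iff _ _).1 (hadj 0) with ⟨h1, _⟩ | ⟨h1, _⟩
  · left
    intro t
    induction t using Fin.induction with
    | zero => simpa using h1.symm
    | succ t ih =>
      have hc := congrArg Fin.val (hcomp t)
      have a1 := (hL.adj_iff _ _).1 (hadj t.castSucc)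
      have a2 := (hL.adj_iff _ _).1 (hadj t.succ)
      simp only [Fin.val_castSucc, Fin.val_succ] at ih ⊢
      rcases a1 with ⟨b1, r1⟩ | ⟨b1, r1⟩
      · rcases a2 with ⟨b2, r2⟩ | ⟨b2, r2⟩
        · omega
        · have : ((p t.succ).2 : ℕ) = (p t.castSucc).1 := by omega
          rw [this] at r2
          exact absurd r1 r2
      · omega
  · right
    intro t
    induction t using Fin.induction with
    | zero => simpa using h1
    | succ t ih =>
      have hc := congrArg Fin.val (hcomp t)
      have a1 := (hL.adj_iff _ _).1 (hadj t.castSucc)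
      have a2 := (hL.adj_iff _ _).1 (hadj t.succ)
      simp only [Fin.val_castSucc, Fin.val_succ] at ih ⊢
      rcases a1 with ⟨b1, r1⟩ | ⟨b1, r1⟩
      · omega
      · rcases a2 with ⟨b2, r2⟩ | ⟨b2, r2⟩
        · have : ((p t.succ).1 : ℕ) = (p t.castSucc).2 := by omega
          rw [this] at r2
          exact absurd r2 r1
        · omega

theorem IsOrientedLinear.isSimplePathIn_of_composable (hL : L.IsOrientedLinear)
    (hadj : ∀ t, L.Adj (p t).1 (p t).2)
    (hcomp : ∀ t : Fin m, (p t.castSucc).2 = (p t.succ).1) : L.IsSimplePathIn p := by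
  refine ⟨⟨hcomp, fun s t h => ?_, fun s t h => ?_, fun h => ?_⟩, hadj⟩
  · have h := congrArg Fin.val h
    simp only at h
    apply Fin.ext
    rcases hL.composable_cases hadj hcomp with hp | hp <;>
    · have := hp s
      have := hp t
      omega
  · have h := congrArg Fin.val h
    simp only at h
    apply Fin.ext
    rcases hL.composable_cases hadj hcomp with hp | hp <;>
    · have := hp s
      have := hp t
      omega
  · have h := congrArg Fin.val h
    rcases hL.composable_cases hadj hcomp with hp | hp <;>
    · have := hp (Fin.last m)
      omega

/-- Take a longest simple path containing `p`. An unstable end would allow one more edge there. -/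
theorem IsOrientedLinear.exists_maximal (hL : L.IsOrientedLinear) (hp : L.IsSimplePathIn p) :
    ∃ (m' : ℕ) (q : Fin (m' + 1) → Fin (n + 1) × Fin (n + 1)), m ≤ m' ∧
      L.IsMaximalSimplePathIn q ∧ Set.range p ⊆ Set.range q ∧
      L.IsStable (q 0).1 ∧ L.IsStable (q (Fin.last m')).2 := by
  classical
  let S : Set ℕ := {m' | ∃ q : Fin (m' + 1) → Fin (n + 1) × Fin (n + 1),
    L.IsSimplePathIn q ∧ Set.range p ⊆ Set.range q}
  have hbdd : BddAbove S := by
    refine ⟨n, ?_⟩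
    rintro m' ⟨q, hq, _⟩
    have := Fintype.card_le_of_injective _ hq.1.source_injective
    simpa using this
  obtain ⟨q, hq, hpq⟩ := Nat.sSup_mem (s := S) ⟨m, p, hp, subset_rfl⟩ hbdd
  have hmax : ∀ m' ∈ S, m' ≤ sSup S := fun m' hm' => le_csSup hbdd hm'
  refine ⟨sSup S, q, hmax m ⟨p, hp, subset_rfl⟩, ⟨hq, fun m' q' hq' hqq' => ?_⟩, hpq, ?_, ?_⟩
  · have hm' := hmax m' ⟨q', hq', hpq.trans hqq'⟩
    have inj : ∀ {l : ℕ} {r : Fin (l + 1) → Fin (n + 1) × Fin (n + 1)}, L.IsSimplePathIn r →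
        Function.Injective r := fun hr s t h => hr.1.source_injective (congrArg Prod.fst h)
    have h1 : Finset.univ.image q ⊆ Finset.univ.image q' := by
      intro x hx
      have : x ∈ Set.range q := by simpa using hx
      simpa using hqq' this
    have h2 := Finset.eq_of_subset_of_card_le h1 (by
      rw [Finset.card_image_of_injective _ (inj hq), Finset.card_image_of_injective _ (inj hq')]
      simpa using hm')
    ext x
    have := Finset.ext_iff.1 h2 x
    simpa using this.symm
  · rintro ⟨_, y, hy⟩
    have : sSup S + 1 ∈ S := by
      refine ⟨Fin.cons (y, (q 0).1) q, hL.isSimplePathIn_of_composable (fun t => ?_)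
        (fun t => ?_), hpq.trans ?_⟩
      · induction t using Fin.cases with
        | zero => simpa using hy
        | succ t => simpa using hq.2 t
      · induction t using Fin.cases with
        | zero => rfl
        | succ t =>
          rw [Fin.castSucc_succ, Fin.cons_succ, Fin.cons_succ]
          exact hq.1.composable t
      · rintro _ ⟨t, rfl⟩
        exact ⟨t.succ, by simp⟩
    have := hmax _ this
    omega
  · rintro ⟨⟨y, hy⟩, _⟩
    have : sSup S + 1 ∈ S := by
      refine ⟨Fin.snoc q ((q (Fin.last _)).2, y), hL.isSimplePathIn_of_composable (fun t => ?_)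
        (fun t => ?_), hpq.trans ?_⟩
      · induction t using Fin.lastCases with
        | last => simpa using hy
        | cast t => simpa using hq.2 t
      · induction t using Fin.lastCases with
        | last => rw [Fin.succ_last, Fin.snoc_last, Fin.snoc_castSucc]
        | cast t =>
          rw [Fin.succ_castSucc, Fin.snoc_castSucc, Fin.snoc_castSucc]
          exact hq.1.composable t
      · rintro _ ⟨t, rfl⟩
        exact ⟨t.castSucc, by simp⟩
    have := hmax _ this
    omega

theorem IsOrientedLinear.isSimplePathIn_cases (hL : L.IsOrientedLinear)
    (hp : L.IsSimplePathIn p) :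
    (∀ t : Fin (m + 1), ((p t).1 : ℕ) = (p 0).1 + t ∧ ((p t).2 : ℕ) = (p 0).1 + t + 1 ∧
      L.IsRightward ((p 0).1 + t)) ∨
    ∀ t : Fin (m + 1), ((p t).1 : ℕ) + t = (p 0).1 ∧ ((p t).2 : ℕ) + t + 1 = (p 0).1 ∧
      ¬ L.IsRightward ((p 0).1 - (t + 1)) := by
  rcases hL.composable_cases hp.2 hp.1.composable with h | h
  · refine Or.inl fun t => ⟨(h t).1, (h t).2, ?_⟩
    rcases (hL.adj_iff _ _).1 (hp.2 t) with ⟨_, hr⟩ | ⟨h1, _⟩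
    · rwa [(h t).1] at hr
    · have := h t
      omega
  · refine Or.inr fun t => ⟨(h t).1, (h t).2, ?_⟩
    rcases (hL.adj_iff _ _).1 (hp.2 t) with ⟨h1, _⟩ | ⟨_, hr⟩
    · have := h t
      omega
    · rwa [show ((p t).2 : ℕ) = (p 0).1 - (t + 1) by have := h t; omega] at hr

/-- The `m` inner vertices of a path with `m + 1` edges are unstable. Here `i` is the smallest
vertex index on the path, which is its end if it runs to the left. -/
theorem IsOrientedLinear.exists_not_isConflict (hL : L.IsOrientedLinear)
    (hp : L.IsSimplePathIn p) : ∃ i, i + m < n ∧ ∀ t < m, ¬ L.IsConflict (i + t) := by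
  rcases hL.isSimplePathIn_cases hp with h | h
  · refine ⟨(p 0).1, ?_, fun t ht hc => hc ?_⟩
    · have := (h (Fin.last m)).2.1
      rw [Fin.val_last] at this
      omega
    · exact iff_of_true (h ⟨t, by omega⟩).2.2 (h ⟨t + 1, by omega⟩).2.2
  · have hm := (h (Fin.last m)).2.1
    rw [Fin.val_last] at hm
    refine ⟨(p 0).1 - (m + 1), ?_, fun t ht hc => hc (iff_of_false ?_ ?_)⟩
    · omega
    · have := (h ⟨m - t, by omega⟩).2.2
      rwa [show ((p 0).1 : ℕ) - (m - t + 1) = (p 0).1 - (m + 1) + t by omega] at this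
    · have := (h ⟨m - (t + 1), by omega⟩).2.2
      rwa [show ((p 0).1 : ℕ) - (m - (t + 1) + 1) = (p 0).1 - (m + 1) + t + 1 by omega] at this

end SimplePath

/-- A path of length two through the edges at a vertex which is not stable. -/
theorem IsOrientedLinear.exists_isSimplePathIn_of_not_isConflict (hL : L.IsOrientedLinear) {i : ℕ}
    (hi : i + 1 < n) (hc : ¬ L.IsConflict i) :
    ∃ p : Fin 2 → Fin (n + 1) × Fin (n + 1), L.IsSimplePathIn p ∧
      L.edgeAt i ∈ Set.range p ∧ L.edgeAt (i + 1) ∈ Set.range p := by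
  have e1 := edgeAt_cases (L := L) (i := i) (by omega)
  have e2 := edgeAt_cases (L := L) hi
  have a1 := hL.adj_edgeAt (i := i) (by omega)
  have a2 := hL.adj_edgeAt hi
  unfold IsConflict at hc
  by_cases hr : L.IsRightward i <;> by_cases hr' : L.IsRightward (i + 1) <;>
    simp only [hr, hr', not_true_eq_false, not_false_eq_true, false_and, true_and, or_false,
      false_or, iff_true, iff_false] at hc e1 e2
  · refine ⟨![L.edgeAt i, L.edgeAt (i + 1)], hL.isSimplePathIn_of_composable (fun t => ?_)
      (fun t => ?_), ⟨0, rfl⟩, ⟨1, rfl⟩⟩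
    · fin_cases t
      · exact a1
      · exact a2
    · obtain rfl : t = 0 := Subsingleton.elim _ _
      exact Fin.ext (e1.2.trans e2.1.symm)
  · refine ⟨![L.edgeAt (i + 1), L.edgeAt i], hL.isSimplePathIn_of_composable (fun t => ?_)
      (fun t => ?_), ⟨1, rfl⟩, ⟨0, rfl⟩⟩
    · fin_cases t
      · exact a2
      · exact a1
    · obtain rfl : t = 0 := Subsingleton.elim _ _
      exact Fin.ext (e2.2.trans e1.1.symm)

theorem IsOrientedLinear.isAlternating_iff (hL : L.IsOrientedLinear) :
    L.IsAlternating ↔ ∀ i, i + 1 < n → L.IsConflict i := by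
  constructor
  · rintro ⟨_, h⟩ i hi
    have := h ⟨i, by omega⟩ ⟨i + 1, by omega⟩ ⟨i + 2, by omega⟩ rfl rfl
    simp only [hL.adj_iff] at this
    unfold IsConflict
    by_cases hr : L.IsRightward i <;> by_cases hr' : L.IsRightward (i + 1) <;>
      simp [hr, hr'] at this ⊢
  · intro h
    refine ⟨hL, fun i j k hij hjk => ?_⟩
    have hc := h i (by omega)
    unfold IsConflict at hc
    rw [hij] at hc
    simp only [hL.adj_iff]
    by_cases hr : L.IsRightward i <;> by_cases hr' : L.IsRightward j <;>
      simp [hr, hr', hij, hjk] at hc ⊢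

/-- An unstable vertex yields a path of length two; its maximal extension joins stable vertices and
violates `D(1)`. -/
theorem IsOrientedLinear.propertyD_one_iff (hL : L.IsOrientedLinear) :
    L.PropertyD 1 ↔ L.IsAlternating := by
  rw [hL.isAlternating_iff]
  constructor
  · intro hD i hi
    by_contra hc
    obtain ⟨p, hp, -⟩ := hL.exists_isSimplePathIn_of_not_isConflict hi hc
    obtain ⟨m', q, hm', hq, -, h1, h2⟩ := hL.exists_maximal hp
    have := hD _ _ h1 h2 m' q hq.1 rfl rfl
    omega
  · intro hc x y _ _ m p hp _ _
    obtain ⟨i, hi, h⟩ := hL.exists_not_isConflict hp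
    by_contra hm
    exact h 0 (by omega) (hc _ (by omega))

/-- A path of length at least three contains an edge between two unstable vertices, and this edge is
an apex. -/
theorem IsOrientedLinear.isConcentrated_none_of_not_propertyD (hL : L.IsOrientedLinear)
    (hD : ¬ L.PropertyD 2) (K : Type u) [Field K] : IsConcentrated K L.IsMultipath none := by
  unfold PropertyD at hD
  push Not at hD
  obtain ⟨x, y, _, _, m, p, hp, _, _, hm⟩ := hD
  obtain ⟨i, hi, h⟩ := hL.exists_not_isConflict hp
  exact hL.isConcentrated_none K (i := i) (by omega) (h 0 (by omega)) (h 1 (by omega))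

theorem IsAlternating.isConcentrated (hL : L.IsAlternating) (K : Type u) [Field K] :
    IsConcentrated K L.IsMultipath (alternatingDegree n) := by
  have := hL.1.isConcentrated K
  rwa [bettiDegree_eq_alternatingDegree (hL.1.isAlternating_iff.1 hL)] at this

/-- The edge between `v_i` and `v_{i+1}` belongs to the reduction unless the next edge continues
it to a longer simple path. -/
theorem IsOrientedLinear.reduction_adj_iff (hL : L.IsOrientedLinear) (a b : Fin (n + 1)) :
    L.reduction.Adj a b ↔
      L.Adj a b ∧ ((min a b : ℕ) + 1 < n → L.IsConflict (min a b : ℕ)) := by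
  refine and_congr_right fun hab => ?_
  obtain ⟨i, hi, e⟩ := hL.exists_eq_edgeAt (x := (a, b)) hab
  have e1 := edgeAt_cases (L := L) hi
  rw [← e] at e1
  simp only at e1
  have hmin : (min a b : ℕ) = i := by omega
  rw [hmin]
  constructor
  · intro h hi'
    by_contra hc
    -- A maximal path through both edges reaches `v_{i+2}`, beyond the edge `(a, b)`.
    obtain ⟨p, hp, hp1, hp2⟩ := hL.exists_isSimplePathIn_of_not_isConflict hi' hc
    obtain ⟨m', q, -, hq, hpq, -⟩ := hL.exists_maximal hp
    obtain ⟨t, ht⟩ := hpq hp2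
    have h1 := h m' q hq (by rw [e]; exact hpq hp1) t
    rw [ht] at h1
    have e2 := edgeAt_cases (L := L) hi'
    simp only [max_le_iff, le_max_iff, Fin.le_def] at h1
    omega
  · rintro hc m p ⟨hp, -⟩ ⟨t, ht⟩ s
    rw [← max_comm b a]
    have ht1 := congrArg (fun x => (x.1 : ℕ)) ht
    have ht2 := congrArg (fun x => (x.2 : ℕ)) ht
    simp only at ht1 ht2
    by_contra hlt
    rw [not_le] at hlt
    simp only [max_lt_iff, lt_max_iff, Fin.lt_def] at hlt
    -- If the path reaches beyond the edge of index `i`, it also contains the edge of index `i + 1`,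
    -- in the same direction. That edge is at position `t + 1` on a rightward path and at `t - 1` on
    -- a leftward one.
    rcases hL.isSimplePathIn_cases hp with h | h
    · have h1 := h s
      have h2 := h t
      have hst : (t : ℕ) + 1 < m + 1 := by omega
      have h3 := h ⟨t + 1, hst⟩
      have h4 := (p ⟨t + 1, hst⟩).2.2
      simp only at h3
      have hi' : i = (p 0).1 + t := by omega
      refine hc (by omega) (iff_of_true (hi' ▸ h2.2.2) ?_)
      rw [hi']
      exact h3.2.2
    · have h1 := h s
      have h2 := h t
      have hst : (t : ℕ) - 1 < m + 1 := by omega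
      have h3 := h ⟨t - 1, hst⟩
      have h4 := (p ⟨t - 1, hst⟩).1.2
      simp only at h3
      have hi' : i = (p 0).1 - (t + 1) := by omega
      refine hc (by omega) (iff_of_false (hi' ▸ h2.2.2) ?_)
      rw [show i + 1 = (p 0).1 - ((t : ℕ) - 1 + 1) by omega]
      exact h3.2.2

end OrientedLinear

end Digraph

/-! ### Connected components as intervals. -/

namespace SimpleGraph

variable {N : ℕ} {G : SimpleGraph (Fin N)}

/-- Reachability in a graph all of whose edges join consecutive vertices. -/
theorem reachable_iff_of_consecutive (hG : ∀ a b, G.Adj a b → (a : ℕ) + 1 = b ∨ (b : ℕ) + 1 = a)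
    {x y : Fin N} (hxy : x ≤ y) : G.Reachable x y ↔
      ∀ a b : Fin N, (a : ℕ) + 1 = b → x ≤ a → b ≤ y → G.Adj a b := by
  constructor
  · rintro ⟨w⟩ a b hab hxa hby
    by_contra hn
    -- Without the edge from `a` to `b = a + 1`, no walk passes beyond `a`.
    have key : ∀ {u v : Fin N}, G.Walk u v → u ≤ a → v ≤ a := by
      intro u v w
      induction w with
      | nil => exact id
      | @cons u v _ h _ ih =>
        intro hu
        refine ih ?_
        by_contra hv
        rw [not_le, Fin.lt_def] at hv
        rw [Fin.le_def] at hu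
        have hcons := hG _ _ h
        have h1 : u = a := Fin.ext (by omega)
        have h2 : v = b := Fin.ext (by omega)
        rw [h1, h2] at h
        exact hn h
    have := key w hxa
    rw [Fin.le_def] at *
    omega
  · intro h
    have key : ∀ (l : ℕ) (hl : (x : ℕ) + l ≤ y), G.Reachable x ⟨x + l, by omega⟩ := by
      intro l
      induction l with
      | zero => intro _; exact Reachable.refl _
      | succ l ih =>
        intro hl
        refine (ih (by omega)).trans (Adj.reachable (h _ _ ?_ ?_ ?_))
        · simp only; omega
        · simp [Fin.le_def]
        · rw [Fin.le_def]; exact hl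
    rw [Fin.le_def] at hxy
    have := key (y - x) (by omega)
    rwa [show (⟨x + (y - x), by omega⟩ : Fin N) = y from Fin.ext (by simp only; omega)] at this

theorem connectedComponentMk_eq_of_between
    (hG : ∀ a b, G.Adj a b → (a : ℕ) + 1 = b ∨ (b : ℕ) + 1 = a)
    {x y z : Fin N} (hxy : x ≤ y) (hyz : y ≤ z)
    (h : G.connectedComponentMk x = G.connectedComponentMk z) :
    G.connectedComponentMk x = G.connectedComponentMk y := by
  have h1 := (reachable_iff_of_consecutive hG (hxy.trans hyz)).1 (ConnectedComponent.exact h)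
  exact ConnectedComponent.sound ((reachable_iff_of_consecutive hG hxy).2
    fun a b hab hxa hby => h1 a b hab hxa (hby.trans hyz))

end SimpleGraph

/-- For monotone `f`, the points with value below `j` form an initial segment, which is determined
by its cardinality. -/
theorem Fin.lt_iff_lt_sum_card_fibers {N h : ℕ} {f : Fin N → Fin h} (hf : Monotone f) (k : ℕ → ℕ)
    (hk : ∀ i : Fin h, (Finset.univ.filter fun x => f x = i).card = k i) {j : ℕ} (hj : j ≤ h)
    (x : Fin N) : (f x : ℕ) < j ↔ (x : ℕ) < ∑ l ∈ Finset.range j, k l := by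
  have hcard : (Finset.univ.filter fun x => (f x : ℕ) < j).card = ∑ l ∈ Finset.range j, k l := by
    clear x
    induction j with
    | zero => simp
    | succ j ih =>
      rw [Finset.sum_range_succ, ← ih (by omega), ← hk ⟨j, hj⟩, ← Finset.card_union_of_disjoint]
      · congr 1
        ext x
        simp only [Finset.mem_filter, Finset.mem_univ, true_and, Finset.mem_union, Fin.ext_iff]
        omega
      · rw [Finset.disjoint_filter]
        intro x _ h1 h2
        rw [h2] at h1
        exact lt_irrefl _ h1
  rw [← hcard]
  constructor
  · intro hx
    have : Finset.Iic x ⊆ Finset.univ.filter fun x => (f x : ℕ) < j := by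
      intro y hy
      have := hf (Finset.mem_Iic.1 hy)
      rw [Fin.le_def] at this
      simpa using this.trans_lt hx
    have := Finset.card_le_card this
    rw [Fin.card_Iic] at this
    omega
  · intro hx
    by_contra hn
    have : (Finset.univ.filter fun x => (f x : ℕ) < j) ⊆ Finset.Iio x := by
      intro y hy
      rw [Finset.mem_Iio]
      by_contra hxy
      have := hf (not_lt.1 hxy)
      rw [Fin.le_def] at this
      have hy : (f y : ℕ) < j := by simpa using hy
      omega
    have := Finset.card_le_card this
    rw [Fin.card_Iio] at this
    omega

/-! ### Components of the reduction and positions of the conflicts. -/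

namespace Digraph

section Reduction

variable {n : ℕ} {L : Digraph (Fin (n + 1))}

theorem IsOrientedLinear.reduction_consecutive (hL : L.IsOrientedLinear) (a b : Fin (n + 1))
    (h : L.reduction.toSimpleGraphInclusive.Adj a b) : (a : ℕ) + 1 = b ∨ (b : ℕ) + 1 = a := by
  rcases h.2 with h | h
  · exact hL.2 a b h.1
  · exact (hL.2 b a h.1).symm

/-- The guard matters: the last edge always survives, whereas `IsConflict` would compare it with an
edge that does not exist. -/
theorem IsOrientedLinear.reduction_inclusive_adj_iff (hL : L.IsOrientedLinear) {a b : Fin (n + 1)}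
    (hab : (a : ℕ) + 1 = b) : L.reduction.toSimpleGraphInclusive.Adj a b ↔
      ((a : ℕ) + 1 < n → L.IsConflict a) := by
  have hmin : (min a b : ℕ) = a := by omega
  have hmin' : (min b a : ℕ) = a := by omega
  constructor
  · rintro ⟨_, h | h⟩
    · have := ((hL.reduction_adj_iff _ _).1 h).2
      rwa [hmin] at this
    · have := ((hL.reduction_adj_iff _ _).1 h).2
      rwa [hmin'] at this
  · intro h
    refine ⟨fun e => ?_, ?_⟩
    · rw [e] at hab
      omega
    · rcases hL.1 a b hab with h' | h'
      · exact Or.inl ((hL.reduction_adj_iff _ _).2 ⟨h'.1, by rwa [hmin]⟩)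
      · exact Or.inr ((hL.reduction_adj_iff _ _).2 ⟨h'.1, by rwa [hmin']⟩)

/-- The position of the components of the reduction. -/
theorem IsOrientedLinear.conflicts_of_hasAlternatingComponents (hL : L.IsOrientedLinear) {h : ℕ}
    {k : Fin h → ℕ} (hk : L.reduction.HasAlternatingComponents k) {k' : ℕ → ℕ}
    (hk' : ∀ i : Fin h, k' i = k i) :
    ∑ l ∈ Finset.range h, (k' l + 1) = n + 1 ∧
    (∀ j < h, ∀ i, ∑ l ∈ Finset.range j, (k' l + 1) ≤ i →
      i < ∑ l ∈ Finset.range j, (k' l + 1) + k' j → i + 1 < n → L.IsConflict i) ∧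
    ∀ j, j + 1 < h → ¬ L.IsConflict (∑ l ∈ Finset.range j, (k' l + 1) + k' j) := by
  classical
  obtain ⟨c, hord, hB⟩ := hk
  let G := L.reduction.toSimpleGraphInclusive
  have hG : ∀ a b, G.Adj a b → (a : ℕ) + 1 = b ∨ (b : ℕ) + 1 = a := hL.reduction_consecutive
  let f : Fin (n + 1) → Fin h := fun x => c.symm (G.connectedComponentMk x)
  have hmem : ∀ x i, x ∈ (c i).supp ↔ f x = i := by
    intro x i
    rw [SimpleGraph.ConnectedComponent.mem_supp_iff, Equiv.symm_apply_eq]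
  have hfeq : ∀ x y, f x = f y ↔ G.connectedComponentMk x = G.connectedComponentMk y :=
    fun x y => c.symm.injective.eq_iff
  -- Components are intervals ordered by their minima, so the component index is monotone in the
  -- vertex.
  have hmono : Monotone f := by
    intro x y hxy
    by_contra hlt
    rw [not_le] at hlt
    obtain ⟨z, hz, hlt'⟩ := hord _ _ hlt
    have hzx := hlt' x ((hmem _ _).2 rfl)
    have hzy := (hfeq _ _).1 ((hmem _ _).1 hz)
    have := SimpleGraph.connectedComponentMk_eq_of_between hG hzx.le hxy hzy
    have := (hfeq _ _).2 (this.symm.trans hzy)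
    exact hlt.ne this.symm
  have hfib : ∀ i : Fin h, (Finset.univ.filter fun x => f x = i).card = k' i + 1 := by
    intro i
    obtain ⟨_, _, φ, _⟩ := hB i
    have h1 := Fintype.card_congr φ
    rw [Fintype.card_fin] at h1
    rw [hk', h1, Fintype.card_subtype]
    congr 1
    ext x
    simp only [Finset.mem_filter, Finset.mem_univ, true_and]
    exact (hmem x i).symm
  have key : ∀ {j : ℕ}, j ≤ h → ∀ x : Fin (n + 1),
      (f x : ℕ) < j ↔ (x : ℕ) < ∑ l ∈ Finset.range j, (k' l + 1) := fun hj x =>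
    Fin.lt_iff_lt_sum_card_fibers hmono (fun l => k' l + 1) hfib hj x
  have hle : ∀ {j : ℕ}, j ≤ h → ∑ l ∈ Finset.range j, (k' l + 1) ≤ n + 1 := by
    intro j hj
    have h1 : ∑ l ∈ Finset.range h, (k' l + 1) = n + 1 := by
      rw [← Fin.sum_univ_eq_sum_range (fun l => k' l + 1)]
      rw [← Finset.sum_congr rfl fun i _ => hfib i,
        ← Finset.card_eq_sum_card_fiberwise fun x _ => Finset.mem_coe.2 (Finset.mem_univ (f x))]
      simp
    rw [← h1]
    exact Finset.sum_le_sum_of_subset (Finset.range_subset_range.2 hj)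
  have hsum : ∑ l ∈ Finset.range h, (k' l + 1) = n + 1 := by
    refine le_antisymm (hle le_rfl) ?_
    have := (key le_rfl (Fin.last n)).1 (f _).2
    rw [Fin.val_last] at this
    omega
  refine ⟨hsum, fun j hj i hi hi' => ?_, fun j hj hc => ?_⟩
  · have hs := Finset.sum_range_succ (fun l => k' l + 1) j
    have hle' := hle (j := j + 1) hj
    let a : Fin (n + 1) := ⟨i, by omega⟩
    let b : Fin (n + 1) := ⟨i + 1, by omega⟩
    have heq : f a = f b := by
      have a1 := key hj.le a
      have a2 := key (j := j + 1) hj a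
      have b1 := key hj.le b
      have b2 := key (j := j + 1) hj b
      simp only [a, b] at a1 a2 b1 b2
      apply Fin.ext
      simp only [a, b]
      omega
    have hab : a ≤ b := by simp [a, b, Fin.le_def]
    have hr := SimpleGraph.ConnectedComponent.exact ((hfeq _ _).1 heq)
    have hadj := (SimpleGraph.reachable_iff_of_consecutive hG hab).1 hr a b rfl le_rfl le_rfl
    exact (hL.reduction_inclusive_adj_iff (a := a) (b := b) rfl).1 hadj
  · have hs := Finset.sum_range_succ (fun l => k' l + 1) j
    have hs' := Finset.sum_range_succ (fun l => k' l + 1) (j + 1)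
    have hle' := hle (j := j + 1 + 1) hj
    generalize hi : ∑ l ∈ Finset.range j, (k' l + 1) + k' j = i at hc
    let a : Fin (n + 1) := ⟨i, by omega⟩
    let b : Fin (n + 1) := ⟨i + 1, by omega⟩
    -- A conflict here would keep the edge from the last vertex of component `j` to the first one of
    -- component `j + 1`.
    have hadj := (hL.reduction_inclusive_adj_iff (a := a) (b := b) rfl).2 fun _ => hc
    have heq : f a = f b := (hfeq _ _).2 (SimpleGraph.ConnectedComponent.sound hadj.reachable)
    have a2 := key (j := j + 1) (by omega) a
    have b2 := key (j := j + 1) (by omega) b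
    rw [← heq] at b2
    simp only [a, b] at a2 b2
    omega

/-- Components are intervals, so enumerating one in increasing order gives a linear graph. A
surviving edge followed by another edge of `L` conflicts with it, which makes the component
alternating. -/
theorem IsOrientedLinear.exists_hasAlternatingComponents (hL : L.IsOrientedLinear) :
    ∃ (h : ℕ) (k : Fin h → ℕ), L.reduction.HasAlternatingComponents k := by
  classical
  let G := L.reduction.toSimpleGraphInclusive
  have hG : ∀ a b, G.Adj a b → (a : ℕ) + 1 = b ∨ (b : ℕ) + 1 = a := hL.reduction_consecutive
  have hne : ∀ c : G.ConnectedComponent, (c.supp.toFinset).Nonempty := by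
    intro c
    obtain ⟨x, hx⟩ := c.nonempty_supp
    exact ⟨x, by simpa using hx⟩
  let f : G.ConnectedComponent → Fin (n + 1) := fun c => c.supp.toFinset.min' (hne c)
  have hf : ∀ c, f c ∈ c.supp := fun c => by simpa using Finset.min'_mem _ (hne c)
  have hfinj : Function.Injective f := by
    intro c c' e
    have h1 := hf c
    have h2 := hf c'
    rw [← e] at h2
    exact h1.symm.trans h2
  let : LinearOrder G.ConnectedComponent := LinearOrder.lift' f hfinj
  let c := Fintype.orderIsoFinOfCardEq G.ConnectedComponent rfl
  refine ⟨_, fun i => (c i).supp.toFinset.card - 1, c.toEquiv, fun i j hij => ?_, fun i => ?_⟩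
  · refine ⟨f (c i), hf _, fun y hy => ?_⟩
    have h1 : f (c i) < f (c j) := c.strictMono hij
    exact h1.trans_le (Finset.min'_le _ _ (by simpa using hy))
  · have hcard : (c i).supp.toFinset.card = (c i).supp.toFinset.card - 1 + 1 := by
      have := Finset.card_pos.2 (hne (c i))
      omega
    beta_reduce
    generalize (c i).supp.toFinset.card - 1 = q at hcard ⊢
    let φ := (c i).supp.toFinset.orderIsoOfFin hcard
    have hφ : ∀ t, G.connectedComponentMk (φ t : Fin (n + 1)) = c i := fun t => by
      have := (φ t).2
      rwa [Set.mem_toFinset] at this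
    -- The increasing enumeration of an interval has no gaps: the vertex after `φ s` is some `φ l`
    -- with `s < l ≤ t`.
    have hstep : ∀ s t : Fin (q + 1), (s : ℕ) + 1 = t →
        ((φ s : Fin (n + 1)) : ℕ) + 1 = (φ t : Fin (n + 1)) := by
      intro s t hst
      have h1 : (φ s : Fin (n + 1)) < φ t := φ.strictMono (by rw [Fin.lt_def]; omega)
      rw [Fin.lt_def] at h1
      let y : Fin (n + 1) := ⟨(φ s : Fin (n + 1)) + 1, by omega⟩
      have hy : G.connectedComponentMk y = c i := by
        rw [← hφ s]
        refine (SimpleGraph.connectedComponentMk_eq_of_between hG ?_ ?_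
          ((hφ s).trans (hφ t).symm)).symm
        · simp [y, Fin.le_def]
        · rw [Fin.le_def]; exact h1
      obtain ⟨l, hl⟩ := φ.surjective ⟨y, by rw [Set.mem_toFinset]; exact hy⟩
      have hly : ((φ l : Fin (n + 1)) : ℕ) = (φ s : Fin (n + 1)) + 1 := by rw [hl]
      have h2 : s < l := by
        rw [← φ.lt_iff_lt]
        change (φ s : Fin (n + 1)) < φ l
        rw [Fin.lt_def]; omega
      have h3 : l ≤ t := by
        rw [← φ.le_iff_le]
        change (φ l : Fin (n + 1)) ≤ φ t
        rw [Fin.le_def]; omega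
      rw [Fin.lt_def] at h2
      rw [Fin.le_def] at h3
      have : l = t := Fin.ext (by omega)
      rw [← hly, this]
    have hval : ∀ t : Fin (q + 1), ((φ t : Fin (n + 1)) : ℕ) = (φ 0 : Fin (n + 1)) + t := by
      intro t
      induction t using Fin.induction with
      | zero => simp
      | succ t ih =>
        rw [← hstep t.castSucc t.succ (by simp), ih]
        simp [add_assoc]
    have hadj : ∀ s t : Fin (q + 1), (s : ℕ) + 1 = t → G.Adj (φ s) (φ t) := by
      intro s t hst
      have h1 := hval s
      have h2 := hval t
      have hle : (φ s : Fin (n + 1)) ≤ φ t := by rw [Fin.le_def]; omega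
      exact (SimpleGraph.reachable_iff_of_consecutive hG hle).1
        (SimpleGraph.ConnectedComponent.exact ((hφ s).trans (hφ t).symm)) _ _ (hstep s t hst)
        le_rfl le_rfl
    have hasymm : ∀ a b, L.Adj a b → ¬ L.Adj b a := by
      intro a b h h'
      have h1 := (hL.adj_iff a b).1 h
      have h2 := (hL.adj_iff b a).1 h'
      rcases h1 with ⟨e1, r1⟩ | ⟨e1, r1⟩ <;> rcases h2 with ⟨e2, r2⟩ | ⟨e2, r2⟩
      · omega
      · exact r2 r1
      · exact r1 r2
      · omega
    refine ⟨⟨fun s t => L.reduction.Adj (φ s) (φ t)⟩, ⟨⟨fun s t hst => ?_, fun s t hst => ?_⟩,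
      fun s t r hst htr => ?_⟩, φ.toEquiv.trans (Equiv.setCongr (Set.coe_toFinset _)),
      fun a b => Iff.rfl⟩
    · rcases (hadj s t hst).2 with h | h
      · exact Or.inl ⟨h, fun h' => hasymm _ _ h.1 h'.1⟩
      · exact Or.inr ⟨h, fun h' => hasymm _ _ h.1 h'.1⟩
    · have h1 := hval s
      have h2 := hval t
      have := hL.2 _ _ hst.1
      omega
    · have h1 := hstep s t hst
      have h2 := hstep t r htr
      have hc := (hL.reduction_inclusive_adj_iff h1).1 (hadj s t hst) (by omega)
      unfold IsConflict at hc
      rw [h1] at hc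
      have e1 := hL.adj_iff (φ s) (φ t)
      have e2 := hL.adj_iff (φ t) (φ r)
      have e3 := hL.adj_iff (φ t) (φ s)
      have e4 := hL.adj_iff (φ r) (φ t)
      constructor
      · intro h
        rcases (hadj t r htr).2 with h' | h'
        · exfalso
          rcases e1.1 h.1 with ⟨_, r1⟩ | ⟨_, _⟩
          · rcases e2.1 h'.1 with ⟨_, r2⟩ | ⟨_, _⟩
            · exact hc (iff_of_true r1 r2)
            · omega
          · omega
        · exact h'
      · intro h
        rcases (hadj t r htr).2 with h' | h'
        · exact h'
        · exfalso
          rcases e3.1 h.1 with ⟨_, _⟩ | ⟨_, r1⟩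
          · omega
          · rcases e4.1 h'.1 with ⟨_, _⟩ | ⟨_, r2⟩
            · omega
            · exact hc (iff_of_false r1 r2)

end Reduction

end Digraph

/-! ### Graded tensor products of spaces concentrated in one degree. -/

section GradedTensor

variable {K : Type u} [Field K]

theorem PiTensorProduct.subsingleton_of_factor {ι : Type*} {N : ι → Type*}
    [∀ i, AddCommGroup (N i)] [∀ i, Module K (N i)] (i : ι) [Subsingleton (N i)] :
    Subsingleton (⨂[K] i, N i) := by
  classical
  refine subsingleton_of_forall_eq 0 fun x => ?_
  induction x using PiTensorProduct.induction_on with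
  | smul_tprod r f =>
    rw [MultilinearMap.map_coord_zero _ i (Subsingleton.elim _ _), smul_zero]
  | add x y hx hy => rw [hx, hy, add_zero]

theorem DirectSum.subsingleton_of_forall {ι : Type*} {N : ι → Type*} [∀ i, AddCommGroup (N i)]
    (h : ∀ i, Subsingleton (N i)) : Subsingleton (⨁ i, N i) :=
  ⟨fun _ _ => DFinsupp.ext fun _ => Subsingleton.elim _ _⟩

theorem DirectSum.nonempty_linearEquiv_of_forall_ne {ι : Type*} {N : ι → Type*}
    [∀ i, AddCommGroup (N i)] [∀ i, Module K (N i)] (i : ι)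
    (h : ∀ j, j ≠ i → Subsingleton (N j)) : Nonempty ((⨁ j, N j) ≃ₗ[K] N i) := by
  classical
  refine ⟨LinearEquiv.ofLinearMap (DirectSum.component K ι N i) (DirectSum.lof K ι N i) ?_ ?_⟩
  · ext x
    simp
  · refine LinearMap.ext fun x => DFinsupp.ext fun j => ?_
    by_cases hj : j = i
    · subst hj
      exact DirectSum.component.lof_self K j _
    · have := h j hj
      exact Subsingleton.elim _ _

variable {ι : Type*} [Fintype ι] {M : ι → ℕ → Type*} [∀ i r, AddCommGroup (M i r)]
  [∀ i r, Module K (M i r)]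

theorem subsingleton_gradedTensor (d : ℕ)
    (h : ∀ r : ι → ℕ, ∑ i, r i = d → ∃ i, Subsingleton (M i (r i))) :
    Subsingleton (⨁ r : {r : ι → ℕ // ∑ i, r i = d}, ⨂[K] i, M i (r.1 i)) :=
  DirectSum.subsingleton_of_forall fun r => by
    obtain ⟨i, hi⟩ := h r.1 r.2
    exact PiTensorProduct.subsingleton_of_factor i

/-- Every multidegree other than `q` has a zero factor, so only a tensor product of lines remains.
-/
theorem nonempty_gradedTensor_linearEquiv (q : ι → ℕ) (e : ∀ i, Nonempty (M i (q i) ≃ₗ[K] K))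
    (h : ∀ i r, r ≠ q i → Subsingleton (M i r)) {d : ℕ} (hd : ∑ i, q i = d) :
    Nonempty ((⨁ r : {r : ι → ℕ // ∑ i, r i = d}, ⨂[K] i, M i (r.1 i)) ≃ₗ[K] K) := by
  classical
  obtain ⟨e₁⟩ := DirectSum.nonempty_linearEquiv_of_forall_ne (K := K)
    (N := fun r : {r : ι → ℕ // ∑ i, r i = d} => ⨂[K] i, M i (r.1 i)) ⟨q, hd⟩ fun r hr => by
      obtain ⟨i, hi⟩ : ∃ i, r.1 i ≠ q i := by
        by_contra hn
        push Not at hn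
        exact hr (Subtype.ext (funext hn))
      have := h i _ hi
      exact PiTensorProduct.subsingleton_of_factor i
  exact ⟨e₁.trans ((PiTensorProduct.congr fun i => (e i).some).trans
    (PiTensorProduct.constantBaseRingEquiv ι K).toLinearEquiv)⟩

end GradedTensor

/-! ### Degrees in terms of the reduction, and the theorem. -/

namespace Digraph

section Main

variable {K : Type u} [Field K]

theorem IsConcentrated.subsingleton {V : Type v} [Fintype V] [LinearOrder V] {G : Digraph V}
    {δ : Option ℕ} (h : IsConcentrated K G.IsMultipath δ) {d : ℕ} (hd : δ ≠ some d) :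
    Subsingleton (G.multipathCohomology K d) := by
  refine subsingleton_multipathCohomology (h.2 d fun k hk e => hd ?_)
  rw [hk]
  simpa using e.symm

theorem IsConcentrated.nonempty_linearEquiv {V : Type v} [Fintype V] [LinearOrder V]
    {G : Digraph V} {δ : Option ℕ} (h : IsConcentrated K G.IsMultipath δ) {d : ℕ}
    (hd : δ = some d) : Nonempty (G.multipathCohomology K d ≃ₗ[K] K) :=
  nonempty_multipathCohomology_linearEquiv (h.1 d hd)

/-- The condition `n = 3(d - 1) + 2` is written without subtraction, so that `d = 0` is treated
correctly. -/
theorem alternatingDegree_eq_some_iff (n d : ℕ) :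
    alternatingDegree n = some d ↔ n + 3 = 3 * d + 2 ∨ n = 3 * d := by
  unfold alternatingDegree
  split_ifs with h
  · simp; omega
  · rw [Option.some_inj]; omega

/-- The degree of the cohomology in terms of the components of the reduction. -/
theorem IsOrientedLinear.bettiDegree_of_hasAlternatingComponents {n : ℕ}
    {L : Digraph (Fin (n + 1))} (hL : L.IsOrientedLinear) {h : ℕ} {k : Fin h → ℕ}
    (hk : L.reduction.HasAlternatingComponents k) :
    ∃ (m : ℕ) (hm : h = m + 1),
      ((∃ j : Fin h, (j : ℕ) + 1 < h ∧ k j ≡ 0 [MOD 3]) →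
        bettiDegree L.IsConflict n = none) ∧
      ((¬ ∃ j : Fin h, (j : ℕ) + 1 < h ∧ k j ≡ 0 [MOD 3]) → bettiDegree L.IsConflict n =
        (alternatingDegree (k ⟨m, by omega⟩)).map
          (∑ i : Fin m, (k ⟨i, by omega⟩ / 3 + 1) + ·)) := by
  let k' : ℕ → ℕ := fun l => if hl : l < h then k ⟨l, hl⟩ else 0
  have hk' : ∀ i : Fin h, k' i = k i := fun i => by simp [k']
  obtain ⟨hsum, hc, hn⟩ := hL.conflicts_of_hasAlternatingComponents hk hk'
  obtain _ | m := h
  · simp at hsum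
  -- The components have `n + 1` vertices in all; the last one has no deleted edge after it and
  -- contributes only `k' m` edges.
  have hs : ∑ l ∈ Finset.range m, (k' l + 1) + k' m = n := by
    rw [Finset.sum_range_succ] at hsum
    omega
  have key := bettiDegree_sum L.IsConflict k' m (fun j hj i hi hi' => hc j (by omega) i hi hi' ?_)
    (fun j hj => hn j (by omega)) (k' m)
    (fun i hi hi' => hc m (by omega) i hi (by omega) (by omega))
  swap
  · have h1 := Finset.sum_le_sum_of_subset (f := fun l => k' l + 1)
      (Finset.range_subset_range.2 (show j + 1 ≤ m from hj))
    rw [Finset.sum_range_succ] at h1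
    omega
  rw [hs] at key
  have hiff : (∃ j : Fin (m + 1), (j : ℕ) + 1 < m + 1 ∧ k j ≡ 0 [MOD 3]) ↔
      ∃ j < m, k' j % 3 = 0 := by
    constructor
    · rintro ⟨j, hj, h0⟩
      exact ⟨j, by omega, by rw [hk']; exact h0⟩
    · rintro ⟨j, hj, h0⟩
      exact ⟨⟨j, by omega⟩, by simpa using hj, by rw [← hk']; exact h0⟩
  refine ⟨m, rfl, fun hex => key.1 (hiff.1 hex), fun hex => ?_⟩
  rw [key.2 (fun hex' => hex (hiff.2 hex')), ← hk' ⟨m, by omega⟩,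
    ← Fin.sum_univ_eq_sum_range (fun l => k' l / 3 + 1)]
  have : ∀ i : Fin m, k' i = k ⟨i, by omega⟩ := fun i => hk' ⟨i, by omega⟩
  simp only [this]

end Main

end Digraph

theorem theorem5p9 {K : Type u} [Field K] {n : ℕ} (L : Digraph (Fin (n + 1)))
    (hL : L.IsOrientedLinear) :
    -- the main case: `D(2)` holds but `D(1)` fails
    (L.PropertyD 2 → ¬ L.PropertyD 1 →
      (∃ (h : ℕ) (k : Fin h → ℕ), L.reduction.HasAlternatingComponents k) ∧
      ∀ (h : ℕ) (k : Fin h → ℕ), L.reduction.HasAlternatingComponents k →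
        ((∃ j : Fin h, (j : ℕ) + 1 < h ∧ k j ≡ 0 [MOD 3]) →
          ∀ d, Subsingleton (L.multipathCohomology K d)) ∧
        ((¬ ∃ j : Fin h, (j : ℕ) + 1 < h ∧ k j ≡ 0 [MOD 3]) →
          -- `A i` is the graph `A_{3⌊k_i/3⌋}` if `i` is not the last index, else `A_{k_i}`
          ∀ A : ∀ i : Fin h, Digraph (Fin ((if (i : ℕ) + 1 < h then 3 * (k i / 3) else k i) + 1)),
            (∀ i, (A i).IsAlternating) →
            (∀ d, d < h - 1 → Subsingleton (L.multipathCohomology K d)) ∧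
            ∀ d, Nonempty (L.multipathCohomology K (d + (h - 1)) ≃ₗ[K]
              ⨁ r : {r : Fin h → ℕ // ∑ i, r i = d},
                ⨂[K] i, (A i).multipathCohomology K (r.1 i)))) ∧
    -- graphs which fail `D(2)` are acyclic
    (¬ L.PropertyD 2 → ∀ d, Subsingleton (L.multipathCohomology K d)) ∧
    -- the graphs with `D(1)` are the alternating ones, and their cohomology
    (L.PropertyD 1 ↔ L.IsAlternating) ∧
    (L.IsAlternating → ∀ d,
      ((n + 3 = 3 * d + 2 ∨ n = 3 * d) → Nonempty (L.multipathCohomology K d ≃ₗ[K] K)) ∧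
      (¬ (n + 3 = 3 * d + 2 ∨ n = 3 * d) → Subsingleton (L.multipathCohomology K d))) := by
  refine ⟨fun _ _ => ⟨hL.exists_hasAlternatingComponents, fun h k hk => ?_⟩,
    fun hD d => (hL.isConcentrated_none_of_not_propertyD hD K).subsingleton (by simp),
    hL.propertyD_one_iff, fun hA d => ⟨fun hd => ?_, fun hd => ?_⟩⟩
  · obtain ⟨m, rfl, hzero, hdeg⟩ := hL.bettiDegree_of_hasAlternatingComponents hk
    have hconc := hL.isConcentrated K
    refine ⟨fun hex d => hconc.subsingleton (by simp [hzero hex]), fun hex A hA => ?_⟩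
    rw [hdeg hex] at hconc
    have hAconc := fun i => (hA i).isConcentrated K
    have hdeg_castSucc : ∀ i : Fin m, Digraph.alternatingDegree
        (if (i.castSucc : ℕ) + 1 < m + 1 then 3 * (k i.castSucc / 3) else k i.castSucc) =
          some (k i.castSucc / 3) := by
      intro i
      rw [if_pos (by simp), Digraph.alternatingDegree_eq_some_iff]
      exact Or.inr rfl
    have hdeg_last : Digraph.alternatingDegree
        (if (Fin.last m : ℕ) + 1 < m + 1 then 3 * (k (Fin.last m) / 3) else k (Fin.last m)) =
          Digraph.alternatingDegree (k (Fin.last m)) := by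
      rw [if_neg (by simp)]
    change Digraph.IsConcentrated K _ ((Digraph.alternatingDegree (k (Fin.last m))).map
      (∑ i : Fin m, (k i.castSucc / 3 + 1) + ·)) at hconc
    -- Separating the ones gives the shift `m = h - 1`.
    rw [Finset.sum_add_distrib] at hconc
    simp only [Finset.sum_const, Finset.card_univ, Fintype.card_fin, smul_eq_mul, mul_one]
      at hconc
    rw [Nat.add_sub_cancel]
    -- If the last component is acyclic, both sides vanish in every degree.
    rcases hlast : Digraph.alternatingDegree (k (Fin.last m)) with _ | b
    · rw [hlast] at hconc
      refine ⟨fun d _ => hconc.subsingleton (by simp), fun d => ?_⟩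
      have h1 := hconc.subsingleton (d := d + m) (by simp)
      have h2 := subsingleton_gradedTensor (K := K)
        (M := fun i r => (A i).multipathCohomology K r) d fun r _ =>
          ⟨Fin.last m, (hAconc _).subsingleton (by rw [hdeg_last, hlast]; simp)⟩
      exact ⟨LinearEquiv.ofSubsingleton _ _⟩
    · rw [hlast, Option.map_some] at hconc
      refine ⟨fun d hd => hconc.subsingleton (by rw [Ne, Option.some_inj]; omega), fun d => ?_⟩
      -- The only multidegree in which no tensor factor vanishes.
      let q : Fin (m + 1) → ℕ := Fin.lastCases b fun i => k i.castSucc / 3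
      have hq : ∑ i, q i = ∑ i : Fin m, k i.castSucc / 3 + b := by
        rw [Fin.sum_univ_castSucc]
        simp [q]
      have hAq : ∀ i : Fin (m + 1), Digraph.alternatingDegree
          (if (i : ℕ) + 1 < m + 1 then 3 * (k i / 3) else k i) = some (q i) := by
        intro i
        induction i using Fin.lastCases with
        | last => rw [hdeg_last, hlast]; simp [q]
        | cast i => rw [hdeg_castSucc]; simp [q]
      have hsub : ∀ i r, r ≠ q i → Subsingleton ((A i).multipathCohomology K r) := fun i r hr =>
        (hAconc i).subsingleton (by rw [hAq, Ne, Option.some_inj]; exact hr.symm)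
      -- Both sides are lines if `d` is the total degree of `q`, and zero otherwise.
      by_cases hd : ∑ i, q i = d
      · obtain ⟨e₁⟩ := hconc.nonempty_linearEquiv (d := d + m) (by
          rw [Option.some_inj]
          omega)
        obtain ⟨e₂⟩ := nonempty_gradedTensor_linearEquiv (K := K)
          (M := fun i r => (A i).multipathCohomology K r) q
          (fun i => (hAconc i).nonempty_linearEquiv (hAq i)) hsub hd
        exact ⟨e₁.trans e₂.symm⟩
      · have h1 := hconc.subsingleton (d := d + m) (by
          rw [Ne, Option.some_inj]
          omega)
        have h2 := subsingleton_gradedTensor (K := K)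
          (M := fun i r => (A i).multipathCohomology K r) d fun r hr => by
            by_contra hn
            push Not at hn
            refine hd ?_
            rw [← hr]
            refine Finset.sum_congr rfl fun i _ => ?_
            by_contra hne
            exact not_subsingleton_iff_nontrivial.2 (hn i) (hsub i _ (Ne.symm hne))
        exact ⟨LinearEquiv.ofSubsingleton _ _⟩
  · exact (hA.isConcentrated K).nonempty_linearEquiv
      ((Digraph.alternatingDegree_eq_some_iff n d).2 hd)
  · exact (hA.isConcentrated K).subsingleton fun e =>
      hd ((Digraph.alternatingDegree_eq_some_iff n d).1 e)
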